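/- Let $0\le k\le n$ be integers and let $s_1,\dots,s_{n-1}$ be the simple reflections of the symmetric group $\mathbb S_n$, with length function $\ell$ and Bruhat order $\prec$. Let $\mathcal H_n$ be the unital associative $\mathbb C(v)$-algebra generated by $H_1,\dots,H_{n-1}$ with relations $H_iH_j=H_jH_i$ for $|i-j|>1$, $H_iH_{i+1}H_i=H_{i+1}H_iH_{i+1}$ and $H_i^2=(v^{-1}-v)H_i+1$. For $w\in\mathbb S_n$ put $H_w=H_{i_1}\cdots H_{i_r}$ for any reduced expression $w=s_{i_1}\cdots s_{i_r}$. The bar involution is the $\mathbb C$-linear ring involution of $\mathcal H_n$ with $\overline v=v^{-1}$ and $\overline{H_w}=H_{w^{-1}}^{-1}$. Let $\{C_w\}_{w\in\mathbb S_n}$ be the Kazhdan--Lusztig basis, that is, the unique $\mathbb C(v)$-basis of $\mathcal H_n$ consisting of bar-invariant elements such that $C_w\in H_w+\sum_{w'\prec w}v\mathbb Z[v]H_{w'}$. Let $W_k=\langle s_1,\dots,s_{k-1}\rangle$ (identified with $\mathbb S_k$) and $W_k^\perp=\langle s_{k+1},\dots,s_{n-1}\rangle$, let $w_k$ be the longest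 element of $W_k$, and let $D$ be the set of shortest representatives of the cosets $(W_k\times W_k^\perp)\backslash\mathbb S_n$. Identify $z\in D$ with the $\wedge\vee$-sequence obtained from $\wedge^k\vee^{n-k}$ by the right action of $z$ on positions, and for $k+1\le i\le n$ let $z^\vee_i$ be $i$ minus the position, counted from the left, of the $(i-k)$-th $\vee$ of $z$. For $k+1\le j\le n$ and $0\le l\le k$ let $t^\vee_{j,l}=s_{j-1}s_{j-2}\cdots s_{j-l}$, with $t^\vee_{j,0}=e$. Then for every $z\in D$ one has $z=t^\vee_{k+1,z^\vee_{k+1}}\cdots t^\vee_{n,z^\vee_n}$, and $$C_{w_kz}=\sum_{w'\in\mathbb S_k}\ \sum_{i_{k+1}=0}^{z^\vee_{k+1}}\cdots\sum_{i_n=0}^{z^\vee_n} v^{\,\ell(w_kz)-\ell(w')-(i_{k+1}+\cdots+i_n)}\,H_{w'\,t^\vee_{k+1,i_{k+1}}\cdots t^\vee_{n,i_n}}.$$ -/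

import Mathlib

namespace SymHecke

/-! ### The symmetric group with its simple reflections

Positions `1, …, n` are the elements of `Fin n` (position `p` is the element with value `p - 1`).
Indices of simple reflections are the natural numbers `1, …, n - 1`. -/

/-- The index set `{1, …, n - 1}` of the simple reflections. -/
abbrev SimpleIdx (n : ℕ) : Type := {i : ℕ // 1 ≤ i ∧ i < n}

/-- The simple reflection `s_i`, exchanging the positions `i` and `i + 1`. -/
def simple {n : ℕ} (i : SimpleIdx n) : Equiv.Perm (Fin n) :=
  Equiv.swap ⟨i.1 - 1, lt_of_le_of_lt (Nat.sub_le _ _) i.2.2⟩ ⟨i.1, i.2.2⟩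

/-- The product `s_{i_1} ⋯ s_{i_r}` of a word in the simple reflections. -/
def wordProd {n : ℕ} (l : List (SimpleIdx n)) : Equiv.Perm (Fin n) :=
  (l.map simple).prod

theorem exists_word {n : ℕ} (w : Equiv.Perm (Fin n)) :
    ∃ l : List (SimpleIdx n), wordProd l = w := by
  cases n with
  | zero => exact ⟨[], Subsingleton.elim _ _⟩
  | succ m =>
    have hw : w ∈ Submonoid.closure
        (Set.range fun i : Fin m => Equiv.swap i.castSucc i.succ) := by
      rw [Equiv.Perm.mclosure_swap_castSucc_succ]; trivial
    induction hw using Submonoid.closure_induction with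
    | mem x hx =>
      obtain ⟨i, rfl⟩ := hx
      refine ⟨[⟨i.1 + 1, by omega, by omega⟩], ?_⟩
      simp only [wordProd, simple, List.map_cons, List.map_nil, List.prod_cons, List.prod_nil,
        mul_one]
      congr 1
    | one => exact ⟨[], rfl⟩
    | mul x y _ _ hx hy =>
      obtain ⟨a, rfl⟩ := hx
      obtain ⟨b, rfl⟩ := hy
      exact ⟨a ++ b, by simp [wordProd]⟩

/-- The length `ℓ(w)`: the least number of simple reflections with product `w`. -/
noncomputable def len {n : ℕ} (w : Equiv.Perm (Fin n)) : ℕ :=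
  sInf {r | ∃ l : List (SimpleIdx n), l.length = r ∧ wordProd l = w}

/-- `l` is a reduced expression of `w`. -/
def IsReducedWord {n : ℕ} (l : List (SimpleIdx n)) (w : Equiv.Perm (Fin n)) : Prop :=
  wordProd l = w ∧ l.length = len w

theorem exists_reducedWord {n : ℕ} (w : Equiv.Perm (Fin n)) :
    ∃ l : List (SimpleIdx n), IsReducedWord l w := by
  have hne : {r | ∃ l : List (SimpleIdx n), l.length = r ∧ wordProd l = w}.Nonempty := by
    obtain ⟨l, hl⟩ := exists_word w
    exact ⟨l.length, l, rfl, hl⟩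
  obtain ⟨l, hl, hw⟩ := Nat.sInf_mem hne
  exact ⟨l, hw, hl⟩

/-- The strict Bruhat order: the transitive closure of the relation `u → u t` for transpositions
`t` (the reflections of the symmetric group) with `ℓ(u) < ℓ(u t)`. -/
def BruhatLT {n : ℕ} : Equiv.Perm (Fin n) → Equiv.Perm (Fin n) → Prop :=
  Relation.TransGen fun u w => ∃ t : Equiv.Perm (Fin n), t.IsSwap ∧ w = u * t ∧ len u < len w

/-! ### The Hecke algebra -/

/-- The field `ℂ(v)`. -/
abbrev K : Type := RatFunc ℂ

/-- The variable `v`. -/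
noncomputable abbrev v : K := RatFunc.X

/-- The defining relations of the Hecke algebra (Soergel's normalization). -/
inductive HeckeRel (n : ℕ) : FreeAlgebra K (SimpleIdx n) → FreeAlgebra K (SimpleIdx n) → Prop
  | comm (i j : SimpleIdx n) (h : 1 < |(i.1 : ℤ) - (j.1 : ℤ)|) :
      HeckeRel n (FreeAlgebra.ι K i * FreeAlgebra.ι K j) (FreeAlgebra.ι K j * FreeAlgebra.ι K i)
  | braid (i j : SimpleIdx n) (h : j.1 = i.1 + 1) :
      HeckeRel n (FreeAlgebra.ι K i * FreeAlgebra.ι K j * FreeAlgebra.ι K i)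
        (FreeAlgebra.ι K j * FreeAlgebra.ι K i * FreeAlgebra.ι K j)
  | quad (i : SimpleIdx n) :
      HeckeRel n (FreeAlgebra.ι K i * FreeAlgebra.ι K i)
        ((v⁻¹ - v) • FreeAlgebra.ι K i + 1)

/-- The Hecke algebra of the symmetric group `S_n` over `ℂ(v)`. -/
def Hecke (n : ℕ) : Type := RingQuot (HeckeRel n)

noncomputable instance (n : ℕ) : Ring (Hecke n) := inferInstanceAs (Ring (RingQuot (HeckeRel n)))

noncomputable instance (n : ℕ) : Algebra K (Hecke n) :=
  inferInstanceAs (Algebra K (RingQuot (HeckeRel n)))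

/-- The quotient map from the free algebra. -/
noncomputable def toHecke (n : ℕ) : FreeAlgebra K (SimpleIdx n) →ₐ[K] Hecke n :=
  RingQuot.mkAlgHom K (HeckeRel n)

theorem toHecke_rel {n : ℕ} {x y : FreeAlgebra K (SimpleIdx n)} (h : HeckeRel n x y) :
    toHecke n x = toHecke n y :=
  RingQuot.mkAlgHom_rel K h

/-- The generator `H_i`. -/
noncomputable def gen {n : ℕ} (i : SimpleIdx n) : Hecke n :=
  toHecke n (FreeAlgebra.ι K i)

/-- The standard basis element `H_w = H_{i_1} ⋯ H_{i_r}`, for a reduced expression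
`w = s_{i_1} ⋯ s_{i_r}` (the product does not depend on which one is chosen). -/
noncomputable def stdBasis {n : ℕ} (w : Equiv.Perm (Fin n)) : Hecke n :=
  ((exists_reducedWord w).choose.map gen).prod

theorem gen_comm {n : ℕ} (i j : SimpleIdx n) (h : 1 < |(i.1 : ℤ) - (j.1 : ℤ)|) :
    gen i * gen j = gen j * gen i := by
  simpa [gen] using toHecke_rel (HeckeRel.comm i j h)

theorem gen_braid {n : ℕ} (i j : SimpleIdx n) (h : j.1 = i.1 + 1) :
    gen i * gen j * gen i = gen j * gen i * gen j := by
  simpa [gen] using toHecke_rel (HeckeRel.braid i j h)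

theorem gen_quad {n : ℕ} (i : SimpleIdx n) :
    gen i * gen i = (v⁻¹ - v) • gen i + 1 := by
  simpa [gen] using toHecke_rel (HeckeRel.quad i)

/-! ### The bar involution -/

theorem v_ne_zero : (v : K) ≠ 0 := RatFunc.X_ne_zero

theorem transcendental_v_inv : Transcendental ℂ (v⁻¹ : K) := by
  intro h
  have h1 : IsAlgebraic ℂ (v : K) := by simpa using h.inv
  have h2 : Transcendental ℂ (algebraMap (Polynomial ℂ) K Polynomial.X) :=
    (transcendental_algebraMap_iff (RatFunc.algebraMap_injective ℂ)).2
      (Polynomial.transcendental_X ℂ)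
  rw [RatFunc.algebraMap_X] at h2
  exact h2 h1

/-- The field endomorphism of `ℂ(v)` over `ℂ` with `v ↦ v⁻¹`. -/
noncomputable def conj : K →ₐ[ℂ] K :=
  (IntermediateField.val _).comp
    (RatFunc.algEquivOfTranscendental (v⁻¹ : K) transcendental_v_inv).toAlgHom

theorem conj_v : conj v = v⁻¹ := by
  simp [conj]

/-- The element `H_i + v - v⁻¹`, the inverse of `H_i`. -/
noncomputable def genInv {n : ℕ} (i : SimpleIdx n) : Hecke n :=
  gen i + (v - v⁻¹) • (1 : Hecke n)

theorem gen_mul_genInv {n : ℕ} (i : SimpleIdx n) : gen i * genInv i = 1 := by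
  rw [genInv, mul_add, gen_quad, mul_smul_comm, mul_one, ← neg_sub v v⁻¹, neg_smul]
  abel

theorem genInv_mul_gen {n : ℕ} (i : SimpleIdx n) : genInv i * gen i = 1 := by
  rw [genInv, add_mul, gen_quad, smul_mul_assoc, one_mul, ← neg_sub v v⁻¹, neg_smul]
  abel

/-- The invertible element `H_i`. -/
noncomputable def genUnit {n : ℕ} (i : SimpleIdx n) : (Hecke n)ˣ :=
  ⟨gen i, genInv i, gen_mul_genInv i, genInv_mul_gen i⟩

/-- The `ℂ(v)`-algebra structure on the Hecke algebra in which `v` acts as `v⁻¹`. -/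
noncomputable abbrev twistedAlgebra (n : ℕ) : Algebra K (Hecke n) :=
  RingHom.toAlgebra' ((algebraMap K (Hecke n)).comp conj.toRingHom)
    (fun c x => Algebra.commutes (conj c) x)

/-- The ring homomorphism underlying `FreeAlgebra.lift`, for an explicit algebra structure. -/
noncomputable def freeLift {X A : Type} [Ring A] (inst : Algebra K A) (f : X → A) :
    FreeAlgebra K X →+* A :=
  (FreeAlgebra.lift K f : FreeAlgebra K X →ₐ[K] A).toRingHom

theorem freeLift_ι {X A : Type} [Ring A] (inst : Algebra K A) (f : X → A) (x : X) :
    freeLift inst f (FreeAlgebra.ι K x) = f x :=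
  FreeAlgebra.lift_ι_apply f x

theorem freeLift_algebraMap {X A : Type} [Ring A] (inst : Algebra K A) (f : X → A) (c : K) :
    freeLift inst f (algebraMap K _ c) = algebraMap K A c :=
  (FreeAlgebra.lift K f : FreeAlgebra K X →ₐ[K] A).commutes c

/-- The ring homomorphism from the free algebra with `v ↦ v⁻¹` and `H_i ↦ H_i⁻¹`. -/
noncomputable def barFree (n : ℕ) : FreeAlgebra K (SimpleIdx n) →+* Hecke n :=
  freeLift (twistedAlgebra n) genInv

theorem barFree_ι {n : ℕ} (i : SimpleIdx n) : barFree n (FreeAlgebra.ι K i) = genInv i :=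
  freeLift_ι (twistedAlgebra n) genInv i

theorem barFree_algebraMap {n : ℕ} (c : K) :
    barFree n (algebraMap K _ c) = algebraMap K (Hecke n) (conj c) :=
  freeLift_algebraMap (twistedAlgebra n) genInv c

theorem barFree_rel {n : ℕ} ⦃x y : FreeAlgebra K (SimpleIdx n)⦄ (h : HeckeRel n x y) :
    barFree n x = barFree n y := by
  cases h with
  | comm i j h =>
    simp only [map_mul, barFree_ι]
    have hu : genUnit j * genUnit i = genUnit i * genUnit j :=
      Units.ext (gen_comm i j h).symm
    have := congrArg (fun u : (Hecke n)ˣ => ((u⁻¹ : (Hecke n)ˣ) : Hecke n)) hu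
    simp only [mul_inv_rev, Units.val_mul] at this
    exact this
  | braid i j h =>
    simp only [map_mul, barFree_ι]
    have hu : genUnit i * genUnit j * genUnit i = genUnit j * genUnit i * genUnit j :=
      Units.ext (gen_braid i j h)
    have := congrArg (fun u : (Hecke n)ˣ => ((u⁻¹ : (Hecke n)ˣ) : Hecke n)) hu
    simp only [mul_inv_rev, Units.val_mul, ← mul_assoc] at this
    exact this
  | quad i =>
    rw [Algebra.smul_def]
    simp only [map_mul, map_add, map_one, barFree_ι, barFree_algebraMap]
    rw [← Algebra.smul_def, map_sub, map_inv₀, conj_v, inv_inv]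
    have h1 : genInv i * genInv i = genInv i * gen i + (v - v⁻¹) • genInv i := by
      conv_lhs => enter [2]; rw [genInv]
      rw [mul_add, mul_smul_comm, mul_one]
    rw [h1, genInv_mul_gen, add_comm]

/-- The bar involution: the ring endomorphism of the Hecke algebra with `v ↦ v⁻¹` and
`H_i ↦ H_i⁻¹`, so that it sends `H_w` to the inverse of `H_{w⁻¹}`. -/
noncomputable def bar (n : ℕ) : Hecke n →+* Hecke n :=
  RingQuot.lift ⟨barFree n, barFree_rel⟩

theorem bar_toHecke {n : ℕ} (x : FreeAlgebra K (SimpleIdx n)) :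
    bar n (toHecke n x) = barFree n x := by
  have h : toHecke n x = RingQuot.mkRingHom (HeckeRel n) x :=
    RingHom.congr_fun (RingQuot.mkAlgHom_coe K (HeckeRel n)) x
  rw [h]
  exact RingQuot.lift_mkRingHom_apply _ _ _

theorem bar_gen {n : ℕ} (i : SimpleIdx n) : bar n (gen i) = genInv i :=
  (bar_toHecke _).trans (barFree_ι i)

theorem bar_algebraMap {n : ℕ} (c : K) :
    bar n (algebraMap K (Hecke n) c) = algebraMap K (Hecke n) (conj c) := by
  rw [← AlgHom.commutes (toHecke n) c, bar_toHecke, barFree_algebraMap]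

/-! ### The Kazhdan–Lusztig basis -/

open Classical in
/-- `C` is the Kazhdan–Lusztig basis: a `ℂ(v)`-basis of the Hecke algebra consisting of
bar-invariant elements with `C_w = H_w + ∑_{w' ≺ w} P_{w',w}(v) H_{w'}` and
`P_{w',w} ∈ v ℤ[v]`. -/
structure IsKLBasis (n : ℕ) (C : Equiv.Perm (Fin n) → Hecke n) : Prop where
  linearIndependent : LinearIndependent K C
  span_eq_top : Submodule.span K (Set.range C) = ⊤
  bar_invariant : ∀ w, bar n (C w) = C w
  unitriangular : ∀ w, ∃ P : Equiv.Perm (Fin n) → Polynomial ℤ,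
    (∀ w', BruhatLT w' w → Polynomial.X ∣ P w') ∧
    C w = stdBasis w + ∑ w' with BruhatLT w' w, Polynomial.aeval v (P w') • stdBasis w'

/-- The Kazhdan–Lusztig basis element `C_w`, where `C` is the unique family satisfying
`IsKLBasis`. -/
noncomputable def klBasis {n : ℕ} (w : Equiv.Perm (Fin n)) : Hecke n :=
  Classical.epsilon (IsKLBasis n) w

/-! ### Combinatorics of the shortest coset representatives -/

/-- `W_k`, generated by `s_1, …, s_{k-1}`; this is the subgroup `S_k` of `S_n`. -/
def parabolic (n k : ℕ) : Subgroup (Equiv.Perm (Fin n)) :=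
  Subgroup.closure {s | ∃ i : SimpleIdx n, i.1 < k ∧ s = simple i}

/-- `W_k^⊥`, generated by `s_{k+1}, …, s_{n-1}`. -/
def parabolicPerp (n k : ℕ) : Subgroup (Equiv.Perm (Fin n)) :=
  Subgroup.closure {s | ∃ i : SimpleIdx n, k < i.1 ∧ s = simple i}

/-- The elements of `W_k` as a finite set. -/
noncomputable def parabolicFinset (n k : ℕ) : Finset (Equiv.Perm (Fin n)) :=
  (Set.toFinite (parabolic n k : Set (Equiv.Perm (Fin n)))).toFinset

/-- `w` is the longest element of `W_k`. -/
def IsLongest {n : ℕ} (k : ℕ) (w : Equiv.Perm (Fin n)) : Prop :=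
  w ∈ parabolic n k ∧ ∀ u ∈ parabolic n k, len u ≤ len w

/-- The set `D` of shortest representatives of the cosets `(W_k × W_k^⊥) z` in `S_n`. -/
def shortestReps (n k : ℕ) : Set (Equiv.Perm (Fin n)) :=
  {z | ∀ u ∈ parabolic n k ⊔ parabolicPerp n k, len z ≤ len (u * z)}

/-- The positions of the `∨`'s in the `∧∨`-sequence of `z`. This sequence is obtained from
`∧⋯∧∨⋯∨` (`k` times `∧`, then `n - k` times `∨`) by the right action of `z` on positions, in
which a product acts by its left factor first; as permutations are composed as functions here,
`z` moves the symbol at `q` to `z⁻¹ q`, and the symbol that arrives at `p` comes from `z p`. -/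
def veeSet {n : ℕ} (k : ℕ) (z : Equiv.Perm (Fin n)) : Finset (Fin n) :=
  Finset.univ.filter fun p => k ≤ (z p).1

theorem card_veeSet {n : ℕ} (k : ℕ) (z : Equiv.Perm (Fin n)) : (veeSet k z).card = n - k := by
  have h : (veeSet k z).map z.toEmbedding = Finset.univ.filter fun p : Fin n => k ≤ p.1 := by
    ext p
    simp only [veeSet, Finset.mem_map, Finset.mem_filter, Finset.mem_univ, true_and,
      Equiv.coe_toEmbedding]
    exact ⟨by rintro ⟨a, ha, rfl⟩; exact ha, fun hp => ⟨z.symm p, by simpa using hp, by simp⟩⟩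
  rw [← Finset.card_map z.toEmbedding, h, ← Finset.card_map Fin.valEmbedding]
  have h2 : (Finset.univ.filter fun p : Fin n => k ≤ p.1).map Fin.valEmbedding
      = Finset.Ico k n := by
    ext a
    simp only [Finset.mem_map, Finset.mem_filter, Finset.mem_univ, true_and,
      Fin.valEmbedding_apply, Finset.mem_Ico]
    exact ⟨by rintro ⟨p, hp, rfl⟩; exact ⟨hp, p.2⟩, fun ha => ⟨⟨a, ha.2⟩, ha.1, rfl⟩⟩
  rw [h2, Nat.card_Ico]

/-- The position, in `{1, …, n}`, of the `(m+1)`-st `∨` in `z`, counted from the left. -/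
def veePos {n : ℕ} (k : ℕ) (z : Equiv.Perm (Fin n)) (m : Fin (n - k)) : ℕ :=
  ((veeSet k z).orderEmbOfFin (card_veeSet k z) m).1 + 1

/-- The entry `z^∨_i` of the `∨`-distance sequence for `i = k + m + 1`, that is, `i` minus the
position of the `(i-k)`-th `∨` of `z`. That `∨` has at most `k` `∧`'s and exactly `m` `∨`'s on
its left, so the difference is never negative for `k ≤ n`. -/
def veeDist {n : ℕ} (k : ℕ) (z : Equiv.Perm (Fin n)) (m : Fin (n - k)) : ℕ :=
  (k + m.1 + 1) - veePos k z m

/-- `s_i` for a natural number `i` (the identity unless `1 ≤ i ≤ n - 1`). -/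
def simpleNat (n i : ℕ) : Equiv.Perm (Fin n) :=
  if h : 1 ≤ i ∧ i < n then simple ⟨i, h⟩ else 1

/-- `t^∨_{j,l} = s_{j-1} s_{j-2} ⋯ s_{j-l}`, with `t^∨_{j,0}` the identity. -/
def tVee (n j l : ℕ) : Equiv.Perm (Fin n) :=
  ((List.range l).map fun q => simpleNat n (j - 1 - q)).prod

/-- `t^∨_{k+1,i_{k+1}} ⋯ t^∨_{n,i_n}`, where `f m` stands for `i_{k+m+1}`. -/
def tVeeProd {n : ℕ} (k : ℕ) (f : Fin (n - k) → ℕ) : Equiv.Perm (Fin n) :=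
  (List.ofFn fun m : Fin (n - k) => tVee n (k + m.1 + 1) (f m)).prod

end SymHecke

/-!
A permutation has a unique normal form `t^∨_{1,a_0} t^∨_{2,a_1} ⋯ t^∨_{n,a_{n-1}}` with `a_j ≤ j`,
its length is the sum of its code `a`, and `H_w` is the product of the corresponding
`H_j H_{j-1} ⋯ H_{j-a_j+1}`. To a code attach the product `X` over `j` of the sums
`S_{j,a_j} = ∑_{q ≤ a_j} v^{a_j-q} H_j ⋯ H_{j-q+1}`. Expanded, it is `∑ v^{ℓ(w)-ℓ(y)} H_y` over the
`y` whose code is at most `a`, so its leading coefficient is `1` and the others lie in `v ℤ[v]`.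

If `j - a_j` is nondecreasing in `j`, then `X` is bar-invariant: the product `Y` of the factors
before `S_{j,a_j}` satisfies `Y H_i = v⁻¹ Y` for `j - a_j < i < j`, and hence
`Y S_{j,l+2} = Y S_{j,l+1} (H_{j-l-1} + v) - Y S_{j,l}` for `l + 2 ≤ a_j`, which gives
bar-invariance by induction on `l` because `H_i + v` is bar-invariant. By the uniqueness of the
Kazhdan–Lusztig basis `X` is then `C_w`. The code of `w_k z` is
`(0, 1, …, k - 1, z^∨_{k+1}, …, z^∨_n)`: there `j - a_j` is `0` for `j < k`, and after that it runs
through the positions of the `∨`'s (counted from `0`) from left to right.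

That the `H_w` form a basis comes from counting dimensions: the normal forms show that the Hecke
algebra has dimension at most `n!`, while the regular representation maps it onto a space of
dimension `n!`.
-/

namespace SymHecke

/-! ### Length and inversions -/

section Length

variable {n : ℕ}

/-- The left one of the two elements of `Fin n` exchanged by `simple i`. -/
def SimpleIdx.lo (i : SimpleIdx n) : Fin n :=
  ⟨i.1 - 1, lt_of_le_of_lt (Nat.sub_le _ _) i.2.2⟩

/-- The right one of the two elements of `Fin n` exchanged by `simple i`. -/
def SimpleIdx.hi (i : SimpleIdx n) : Fin n := ⟨i.1, i.2.2⟩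

theorem SimpleIdx.lo_lt_hi (i : SimpleIdx n) : i.lo < i.hi :=
  Nat.sub_lt i.2.1 one_pos

theorem simple_eq_swap (i : SimpleIdx n) : simple i = Equiv.swap i.lo i.hi := rfl

@[simp] theorem simple_mul_self (i : SimpleIdx n) : simple i * simple i = 1 :=
  Equiv.swap_mul_self _ _

@[simp] theorem simple_inv (i : SimpleIdx n) : (simple i)⁻¹ = simple i :=
  Equiv.swap_inv _ _

@[simp] theorem simple_apply_simple_apply (i : SimpleIdx n) (x : Fin n) :
    simple i (simple i x) = x :=
  Equiv.swap_apply_self _ _ x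

@[simp] theorem simple_lo (i : SimpleIdx n) : simple i i.lo = i.hi :=
  Equiv.swap_apply_left _ _

@[simp] theorem simple_hi (i : SimpleIdx n) : simple i i.hi = i.lo :=
  Equiv.swap_apply_right _ _

@[simp] theorem mul_simple_mul_simple (w : Equiv.Perm (Fin n)) (i : SimpleIdx n) :
    w * simple i * simple i = w := by
  rw [mul_assoc, simple_mul_self, mul_one]

theorem apply_lo_lt_or_gt (w : Equiv.Perm (Fin n)) (i : SimpleIdx n) :
    w i.lo < w i.hi ∨ w i.hi < w i.lo :=
  lt_or_gt_of_ne (w.injective.ne i.lo_lt_hi.ne)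

theorem simple_apply_lt (i : SimpleIdx n) {x y : Fin n} (h : x < y)
    (hne : ¬(x = i.lo ∧ y = i.hi)) : simple i x < simple i y := by
  have hlo : i.lo.1 = i.1 - 1 := rfl
  have hhi : i.hi.1 = i.1 := rfl
  simp only [simple_eq_swap, Equiv.swap_apply_def, Fin.ext_iff, Fin.lt_def] at *
  split_ifs <;> omega

theorem strictMonoOn_of_lo_lt_hi {α : Type*} [Preorder α] {f : Fin n → α} {k : ℕ}
    (h : ∀ i : SimpleIdx n, k < i.1 → f i.lo < f i.hi) : StrictMonoOn f {x | k ≤ x.1} := by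
  rintro ⟨x, hx⟩ (hkx : k ≤ x) ⟨y, hy⟩ - (hxy : x + 1 ≤ y)
  induction y, hxy using Nat.le_induction with
  | base => exact h ⟨x + 1, by omega, hy⟩ (Nat.lt_succ_of_le hkx)
  | succ y hxy ih =>
    exact (ih (by omega)).trans
      (h ⟨y + 1, by omega, hy⟩ (Nat.lt_succ_of_le (hkx.trans (Nat.le_of_succ_le hxy))))

theorem eq_one_of_forall_lo_lt_hi {w : Equiv.Perm (Fin n)}
    (h : ∀ i : SimpleIdx n, w i.lo < w i.hi) : w = 1 := by
  have hmono : StrictMono w := fun x y hxy =>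
    strictMonoOn_of_lo_lt_hi (k := 0) (fun i _ => h i) (Nat.zero_le _) (Nat.zero_le _) hxy
  have := Subsingleton.elim (hmono.orderIsoOfSurjective w w.surjective) (OrderIso.refl _)
  exact Equiv.ext fun x => congrArg (fun e : Fin n ≃o Fin n => e x) this

/-- The set of inversions of a permutation. -/
def inversions (w : Equiv.Perm (Fin n)) : Finset (Fin n × Fin n) :=
  Finset.univ.filter fun p => p.1 < p.2 ∧ w p.2 < w p.1

theorem mem_inversions {w : Equiv.Perm (Fin n)} {p : Fin n × Fin n} :
    p ∈ inversions w ↔ p.1 < p.2 ∧ w p.2 < w p.1 := by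
  simp [inversions]

@[simp] theorem inversions_one : inversions (1 : Equiv.Perm (Fin n)) = ∅ :=
  Finset.eq_empty_of_forall_notMem fun _ hp => (mem_inversions.1 hp).1.asymm (mem_inversions.1 hp).2

theorem card_inversions_mul_simple {w : Equiv.Perm (Fin n)} {i : SimpleIdx n}
    (h : w i.lo < w i.hi) :
    (inversions (w * simple i)).card = (inversions w).card + 1 := by
  have hmem : (i.lo, i.hi) ∈ inversions (w * simple i) :=
    mem_inversions.2 ⟨i.lo_lt_hi, by simpa using h⟩
  rw [← Finset.card_erase_add_one hmem, Nat.add_right_cancel_iff]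
  refine Finset.card_equiv ((simple i).prodCongr (simple i)) fun ⟨x, y⟩ => ?_
  simp only [Finset.mem_erase, mem_inversions, Equiv.prodCongr_apply, Prod.map_apply,
    Equiv.Perm.mul_apply, Prod.ext_iff, ne_eq]
  constructor
  · rintro ⟨hne, hlt, hw⟩
    exact ⟨simple_apply_lt i hlt hne, hw⟩
  · rintro ⟨hlt, hw⟩
    refine ⟨?_, ?_, hw⟩
    · rintro ⟨rfl, rfl⟩
      simp only [simple_lo, simple_hi] at hlt
      exact hlt.asymm i.lo_lt_hi
    · have hne : ¬(simple i x = i.lo ∧ simple i y = i.hi) := fun hxy => by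
        rw [hxy.1, hxy.2] at hw
        exact hw.asymm h
      simpa using simple_apply_lt i hlt hne

theorem card_inversions_mul_simple_of_gt {w : Equiv.Perm (Fin n)} {i : SimpleIdx n}
    (h : w i.hi < w i.lo) :
    (inversions (w * simple i)).card + 1 = (inversions w).card := by
  rw [← card_inversions_mul_simple (w := w * simple i) (i := i) (by simpa using h),
    mul_simple_mul_simple]

theorem wordProd_append_singleton (l : List (SimpleIdx n)) (i : SimpleIdx n) :
    wordProd (l ++ [i]) = wordProd l * simple i := by
  simp [wordProd]

theorem wordProd_reverse (l : List (SimpleIdx n)) : wordProd l.reverse = (wordProd l)⁻¹ := by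
  simp [wordProd, List.prod_inv_reverse, Function.comp_def]

theorem card_inversions_wordProd_le (l : List (SimpleIdx n)) :
    (inversions (wordProd l)).card ≤ l.length := by
  induction l using List.reverseRecOn with
  | nil => simp [wordProd]
  | append_singleton l i ih =>
    rw [wordProd_append_singleton, List.length_append, List.length_singleton]
    rcases apply_lo_lt_or_gt (wordProd l) i with h | h
    · rw [card_inversions_mul_simple h]; omega
    · have := card_inversions_mul_simple_of_gt h; omega

theorem exists_descent {w : Equiv.Perm (Fin n)} (h : w ≠ 1) :
    ∃ i : SimpleIdx n, w i.hi < w i.lo := by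
  by_contra! hle
  exact h (eq_one_of_forall_lo_lt_hi fun i =>
    (apply_lo_lt_or_gt w i).resolve_right (hle i).not_gt)

theorem exists_word_card_inversions (w : Equiv.Perm (Fin n)) :
    ∃ l : List (SimpleIdx n), l.length = (inversions w).card ∧ wordProd l = w := by
  induction hm : (inversions w).card using Nat.strong_induction_on generalizing w with
  | _ m ih =>
    rcases eq_or_ne w 1 with rfl | hw
    · exact ⟨[], by simpa using hm, rfl⟩
    · obtain ⟨i, hi⟩ := exists_descent hw
      have hcard := card_inversions_mul_simple_of_gt hi
      obtain ⟨l, hl, hlw⟩ := ih _ (by omega) (w * simple i) rfl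
      exact ⟨l ++ [i], by simp only [List.length_append, List.length_singleton]; omega,
        by rw [wordProd_append_singleton, hlw, mul_simple_mul_simple]⟩

theorem len_wordProd_le (l : List (SimpleIdx n)) : len (wordProd l) ≤ l.length :=
  Nat.sInf_le ⟨l, rfl, rfl⟩

theorem len_eq_card_inversions (w : Equiv.Perm (Fin n)) : len w = (inversions w).card := by
  apply le_antisymm
  · obtain ⟨l, hl, rfl⟩ := exists_word_card_inversions w
    exact (len_wordProd_le l).trans hl.le
  · obtain ⟨l, rfl, hlen⟩ := exists_reducedWord w
    exact (card_inversions_wordProd_le l).trans hlen.le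

theorem len_mul_simple {w : Equiv.Perm (Fin n)} {i : SimpleIdx n}
    (h : w i.lo < w i.hi) : len (w * simple i) = len w + 1 := by
  simp only [len_eq_card_inversions, card_inversions_mul_simple h]

theorem len_mul_simple_of_gt {w : Equiv.Perm (Fin n)} {i : SimpleIdx n}
    (h : w i.hi < w i.lo) : len (w * simple i) + 1 = len w := by
  simp only [len_eq_card_inversions, card_inversions_mul_simple_of_gt h]

@[simp] theorem len_one : len (1 : Equiv.Perm (Fin n)) = 0 := by
  simp [len_eq_card_inversions]

theorem len_inv (w : Equiv.Perm (Fin n)) : len w⁻¹ = len w := by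
  have hle (u : Equiv.Perm (Fin n)) : len u⁻¹ ≤ len u := by
    obtain ⟨l, rfl, hlen⟩ := exists_reducedWord u
    rw [← hlen, ← wordProd_reverse, ← List.length_reverse]
    exact len_wordProd_le _
  exact le_antisymm (hle w) (by simpa using hle w⁻¹)

theorem len_simple_mul_of_gt {w : Equiv.Perm (Fin n)} {i : SimpleIdx n}
    (h : w⁻¹ i.hi < w⁻¹ i.lo) : len (simple i * w) + 1 = len w := by
  rw [← len_inv (simple i * w), mul_inv_rev, simple_inv, len_mul_simple_of_gt h, len_inv]

end Length

/-! ### The Bruhat order -/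

section Bruhat

variable {n : ℕ}

theorem inversion_of_not_swap_lt {u : Equiv.Perm (Fin n)} {a b x y : Fin n} (hab : a < b)
    (h : u a < u b) (hxy : x < y) (hu : u y < u x)
    (hswap : ¬ Equiv.swap a b x < Equiv.swap a b y) :
    (u * Equiv.swap a b) y < (u * Equiv.swap a b) x := by
  simp only [Equiv.Perm.mul_apply, Equiv.swap_apply_def] at *
  split_ifs at * <;> grind

theorem len_lt_len_mul_swap {u : Equiv.Perm (Fin n)} {a b : Fin n} (hab : a < b)
    (h : u a < u b) : len u < len (u * Equiv.swap a b) := by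
  set t := Equiv.swap a b with ht
  have htt (x : Fin n) : t (t x) = x := Equiv.swap_apply_self a b x
  have hmem : (a, b) ∈ inversions (u * t) := by
    simpa [mem_inversions, ht] using ⟨hab, h⟩
  rw [len_eq_card_inversions, len_eq_card_inversions, ← Finset.card_erase_add_one hmem,
    Nat.lt_succ_iff]
  refine Finset.card_le_card_of_injOn
    (fun p => if t p.1 < t p.2 then (t p.1, t p.2) else p) ?_ ?_
  · rintro ⟨x, y⟩ hxy
    obtain ⟨hlt, hu⟩ := mem_inversions.1 hxy
    dsimp only at hlt hu ⊢
    rw [Finset.mem_coe, Finset.mem_erase, mem_inversions]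
    split_ifs with hc
    · exact ⟨by grind, hc, by simpa [htt] using hu⟩
    · exact ⟨by grind, hlt, inversion_of_not_swap_lt hab h hlt hu hc⟩
  · rintro ⟨x, y⟩ hxy ⟨x', y'⟩ hxy' heq
    have := (mem_inversions.1 hxy).1
    have := (mem_inversions.1 hxy').1
    grind

/-- The relation whose transitive closure is the strict Bruhat order. -/
def BruhatStep (u w : Equiv.Perm (Fin n)) : Prop :=
  ∃ t : Equiv.Perm (Fin n), t.IsSwap ∧ w = u * t ∧ len u < len w

theorem BruhatStep.bruhatLT {u w : Equiv.Perm (Fin n)} (h : BruhatStep u w) : BruhatLT u w :=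
  Relation.TransGen.single h

theorem BruhatLT.trans {u w x : Equiv.Perm (Fin n)} (h : BruhatLT u w) (h' : BruhatLT w x) :
    BruhatLT u x :=
  Relation.TransGen.trans h h'

theorem BruhatLT.len_lt {u w : Equiv.Perm (Fin n)} (h : BruhatLT u w) : len u < len w := by
  induction h with
  | single h => exact h.choose_spec.2.2
  | tail _ h ih => exact ih.trans h.choose_spec.2.2

theorem bruhatLT_mul_simple {w : Equiv.Perm (Fin n)} {i : SimpleIdx n} (h : w i.lo < w i.hi) :
    BruhatLT w (w * simple i) :=
  BruhatStep.bruhatLT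
    ⟨simple i, ⟨i.lo, i.hi, i.lo_lt_hi.ne, rfl⟩, rfl, by rw [len_mul_simple h]; exact lt_add_one _⟩

theorem BruhatStep.exists_swap {u w : Equiv.Perm (Fin n)} (h : BruhatStep u w) :
    ∃ a b : Fin n, a < b ∧ u a < u b ∧ w = u * Equiv.swap a b := by
  obtain ⟨_, ⟨a, b, hab, rfl⟩, rfl, hlt⟩ := h
  wlog hlt' : a < b generalizing a b
  · rw [Equiv.swap_comm] at hlt ⊢
    exact this b a hab.symm hlt (lt_of_le_of_ne (not_lt.1 hlt') hab.symm)
  refine ⟨a, b, hlt', (lt_or_gt_of_ne (u.injective.ne hab)).resolve_right fun hba => ?_, rfl⟩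
  have := len_lt_len_mul_swap (u := u * Equiv.swap a b) hlt' (by simpa using hba)
  rw [mul_assoc, Equiv.swap_mul_self, mul_one] at this
  exact hlt.asymm this

theorem BruhatStep.mul_simple {u w : Equiv.Perm (Fin n)} (h : BruhatStep u w)
    (i : SimpleIdx n) : w = u * simple i ∨ BruhatStep (u * simple i) (w * simple i) := by
  obtain ⟨a, b, hab, hu, rfl⟩ := h.exists_swap
  refine or_iff_not_imp_left.2 fun hne => ?_
  have hconj : u * Equiv.swap a b * simple i
      = u * simple i * Equiv.swap (simple i a) (simple i b) := by
    simp only [Equiv.swap_apply_apply, simple_inv, ← mul_assoc, mul_simple_mul_simple]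
  refine ⟨_, ⟨_, _, (simple i).injective.ne hab.ne, rfl⟩, hconj, ?_⟩
  rw [hconj]
  refine len_lt_len_mul_swap (simple_apply_lt i hab ?_) (by simpa using hu)
  rintro ⟨rfl, rfl⟩
  exact hne rfl

theorem BruhatLT.mul_simple {u w : Equiv.Perm (Fin n)} {i : SimpleIdx n} (h : BruhatLT u w)
    (hw : w i.lo < w i.hi) : BruhatLT (u * simple i) (w * simple i) := by
  induction h using Relation.TransGen.head_induction_on with
  | single h =>
    rcases BruhatStep.mul_simple h i with rfl | h
    · exact bruhatLT_mul_simple hw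
    · exact h.bruhatLT
  | head h hlt ih =>
    rcases BruhatStep.mul_simple h i with rfl | h
    · exact BruhatLT.trans hlt (bruhatLT_mul_simple hw)
    · exact h.bruhatLT.trans ih

end Bruhat

/-! ### The regular representation -/

section RegularRepresentation

variable {n : ℕ}

theorem simple_apply_of_ne {i : SimpleIdx n} {x : Fin n} (hlo : x ≠ i.lo) (hhi : x ≠ i.hi) :
    simple i x = x :=
  Equiv.swap_apply_of_ne_of_ne hlo hhi

theorem simple_apply_of_far {i j : SimpleIdx n} (h : 1 < |(i.1 : ℤ) - (j.1 : ℤ)|) :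
    simple i j.lo = j.lo ∧ simple i j.hi = j.hi := by
  have hi := i.2.1
  have hj := j.2.1
  rw [lt_abs] at h
  constructor <;> apply simple_apply_of_ne <;>
    simp only [SimpleIdx.lo, SimpleIdx.hi, ne_eq, Fin.mk.injEq] <;> omega

theorem simple_comm {i j : SimpleIdx n} (h : 1 < |(i.1 : ℤ) - (j.1 : ℤ)|) :
    simple i * simple j = simple j * simple i := by
  have hconj := Equiv.swap_apply_apply (simple i) j.lo j.hi
  rw [(simple_apply_of_far h).1, (simple_apply_of_far h).2, eq_mul_inv_iff_mul_eq] at hconj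
  exact hconj.symm

theorem lo_eq_hi_of_succ {i j : SimpleIdx n} (h : j.1 = i.1 + 1) : j.lo = i.hi :=
  Fin.ext (Nat.sub_eq_of_eq_add h)

theorem simple_apply_hi_of_succ {i j : SimpleIdx n} (h : j.1 = i.1 + 1) :
    simple i j.hi = j.hi :=
  simple_apply_of_ne (i.lo_lt_hi.trans (lo_eq_hi_of_succ h ▸ j.lo_lt_hi)).ne'
    (lo_eq_hi_of_succ h ▸ j.lo_lt_hi).ne'

theorem simple_apply_lo_of_succ {i j : SimpleIdx n} (h : j.1 = i.1 + 1) :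
    simple j i.lo = i.lo :=
  simple_apply_of_ne (lo_eq_hi_of_succ h ▸ i.lo_lt_hi).ne
    (i.lo_lt_hi.trans (lo_eq_hi_of_succ h ▸ j.lo_lt_hi)).ne

theorem simple_braid {i j : SimpleIdx n} (h : j.1 = i.1 + 1) :
    simple i * simple j * simple i = simple j * simple i * simple j := by
  have hi := Equiv.swap_apply_apply (simple i) j.lo j.hi
  have hj := Equiv.swap_apply_apply (simple j) i.lo i.hi
  rw [lo_eq_hi_of_succ h, simple_hi, simple_apply_hi_of_succ h, ← lo_eq_hi_of_succ h,
    simple_inv] at hi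
  rw [← lo_eq_hi_of_succ h, simple_lo, simple_apply_lo_of_succ h, lo_eq_hi_of_succ h,
    simple_inv] at hj
  exact hi.symm.trans hj

variable {R α : Type*} [CommRing R] [LinearOrder α]

/-- The coefficient of `H_w` in `H_i H_w` when the quadratic relation is `H_i² = q H_i + 1`, as a
function of the positions `x` and `y` in `w` of the two values exchanged by `s_i`. -/
def quadCoeff (q : R) (x y : α) : R := if x < y then 0 else q

theorem quadCoeff_sq (q : R) (x y : α) : quadCoeff q x y ^ 2 = q * quadCoeff q x y := by
  unfold quadCoeff
  split_ifs <;> ring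

theorem quadCoeff_add_swap (q : R) {x y : α} (h : x ≠ y) :
    quadCoeff q x y + quadCoeff q y x = q := by
  rcases lt_or_gt_of_ne h with h | h <;> simp [quadCoeff, h, h.not_gt]

theorem quadCoeff_braid (q : R) {x y : α} (z : α) (hxy : x ≠ y) :
    quadCoeff q x z * (quadCoeff q x y + quadCoeff q y z)
      = q * quadCoeff q x z + quadCoeff q x y * quadCoeff q y z := by
  unfold quadCoeff
  split_ifs <;> first | ring1 | order

/-- The operator by which `H_i` acts from the left when `H_i² = q H_i + 1`, with the basis vector
at `w` standing for `H_w`. -/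
noncomputable def leftOp (q : R) (i : SimpleIdx n) :
    (Equiv.Perm (Fin n) →₀ R) →ₗ[R] (Equiv.Perm (Fin n) →₀ R) :=
  Finsupp.linearCombination R fun w : Equiv.Perm (Fin n) =>
    Finsupp.single (simple i * w) (1 : R)
      + quadCoeff q (w⁻¹ i.lo) (w⁻¹ i.hi) • Finsupp.single w (1 : R)

theorem leftOp_single (q : R) (i : SimpleIdx n) (w : Equiv.Perm (Fin n)) :
    leftOp q i (Finsupp.single w 1) = Finsupp.single (simple i * w) 1
      + quadCoeff q (w⁻¹ i.lo) (w⁻¹ i.hi) • Finsupp.single w 1 := by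
  rw [leftOp, Finsupp.linearCombination_single, one_smul]

theorem inv_simple_mul_apply (i : SimpleIdx n) (w : Equiv.Perm (Fin n)) (x : Fin n) :
    (simple i * w)⁻¹ x = w⁻¹ (simple i x) := by
  rw [mul_inv_rev, simple_inv, Equiv.Perm.mul_apply]

@[simp] theorem simple_mul_simple_mul (i : SimpleIdx n) (w : Equiv.Perm (Fin n)) :
    simple i * (simple i * w) = w := by
  rw [← mul_assoc, simple_mul_self, one_mul]

theorem leftOp_quad (q : R) (i : SimpleIdx n) :
    leftOp q i * leftOp q i = q • leftOp q i + 1 := by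
  refine Finsupp.lhom_ext' fun w => LinearMap.ext_ring ?_
  simp only [LinearMap.comp_apply, Finsupp.lsingle_apply, Module.End.mul_apply,
    LinearMap.add_apply, LinearMap.smul_apply, Module.End.one_apply, leftOp_single, map_add,
    map_smul, inv_simple_mul_apply, simple_lo, simple_hi, simple_mul_simple_mul]
  linear_combination (norm := module)
    quadCoeff_add_swap q (w⁻¹.injective.ne i.lo_lt_hi.ne) • Finsupp.single (simple i * w) (1 : R)
    + quadCoeff_sq q (w⁻¹ i.lo) (w⁻¹ i.hi) • Finsupp.single w (1 : R)

theorem leftOp_comm (q : R) {i j : SimpleIdx n} (h : 1 < |(i.1 : ℤ) - (j.1 : ℤ)|) :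
    leftOp q i * leftOp q j = leftOp q j * leftOp q i := by
  refine Finsupp.lhom_ext' fun w => LinearMap.ext_ring ?_
  obtain ⟨hij, hij'⟩ := simple_apply_of_far h
  obtain ⟨hji, hji'⟩ := simple_apply_of_far (abs_sub_comm (i.1 : ℤ) j.1 ▸ h)
  simp only [LinearMap.comp_apply, Finsupp.lsingle_apply, Module.End.mul_apply, leftOp_single,
    map_add, map_smul, inv_simple_mul_apply, hij, hij', hji, hji', ← mul_assoc, simple_comm h]
  module

theorem leftOp_braid (q : R) {i j : SimpleIdx n} (h : j.1 = i.1 + 1) :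
    leftOp q i * leftOp q j * leftOp q i = leftOp q j * leftOp q i * leftOp q j := by
  refine Finsupp.lhom_ext' fun w => LinearMap.ext_ring ?_
  have hij : simple j i.hi = j.hi := by rw [← lo_eq_hi_of_succ h, simple_lo]
  have hji : simple j j.hi = i.hi := by rw [← lo_eq_hi_of_succ h, simple_hi]
  have hbraid : simple j * (simple i * (simple j * w))
      = simple i * (simple j * (simple i * w)) := by
    simp only [← mul_assoc, simple_braid h]
  simp only [LinearMap.comp_apply, Finsupp.lsingle_apply, Module.End.mul_apply, leftOp_single,
    map_add, map_smul, inv_simple_mul_apply, simple_lo, simple_hi, simple_mul_simple_mul,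
    lo_eq_hi_of_succ h, simple_apply_hi_of_succ h, simple_apply_lo_of_succ h, hij, hji, hbraid]
  have hlo : w⁻¹ i.lo ≠ w⁻¹ i.hi := w⁻¹.injective.ne i.lo_lt_hi.ne
  have hhi : w⁻¹ i.hi ≠ w⁻¹ j.hi := w⁻¹.injective.ne (lo_eq_hi_of_succ h ▸ j.lo_lt_hi.ne)
  generalize w⁻¹ i.lo = x at *
  generalize w⁻¹ i.hi = y at *
  generalize w⁻¹ j.hi = z at *
  linear_combination (norm := module)
    (quadCoeff q x z * quadCoeff_add_swap q hlo - quadCoeff_braid q z hlo)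
      • Finsupp.single (simple i * w) (1 : R)
    + (quadCoeff_braid q z hlo - quadCoeff q x z * quadCoeff_add_swap q hhi)
      • Finsupp.single (simple j * w) (1 : R)
    + (quadCoeff q y z * quadCoeff_sq q x y - quadCoeff q x y * quadCoeff_sq q y z)
      • Finsupp.single w (1 : R)

/-- The left regular representation. -/
noncomputable def regRep (n : ℕ) : Hecke n →ₐ[K] Module.End K (Equiv.Perm (Fin n) →₀ K) :=
  RingQuot.liftAlgHom K ⟨FreeAlgebra.lift K (leftOp (v⁻¹ - v)), by
    intro x y h
    cases h with
    | comm i j h => simpa using leftOp_comm _ h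
    | braid i j h => simpa using leftOp_braid _ h
    | quad i => simpa using leftOp_quad _ i⟩

theorem regRep_gen (i : SimpleIdx n) : regRep n (gen i) = leftOp (v⁻¹ - v) i :=
  (RingQuot.liftAlgHom_mkAlgHom_apply K _ _ _).trans (FreeAlgebra.lift_ι_apply (leftOp _) i)

theorem regRep_genProd_single_one {w : Equiv.Perm (Fin n)} {l : List (SimpleIdx n)}
    (h : IsReducedWord l w) :
    regRep n (l.map gen).prod (Finsupp.single 1 1) = Finsupp.single w 1 := by
  obtain ⟨rfl, hl⟩ := h
  induction l with
  | nil => simp [wordProd]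
  | cons i l ih =>
    have hcons : wordProd (i :: l) = simple i * wordProd l := List.prod_cons
    have hle := len_wordProd_le l
    rw [hcons, List.length_cons] at hl
    have hlt : (wordProd l)⁻¹ i.lo < (wordProd l)⁻¹ i.hi := by
      refine (apply_lo_lt_or_gt (wordProd l)⁻¹ i).resolve_right fun hgt => ?_
      have := len_simple_mul_of_gt hgt
      omega
    have hlen : len (simple i * wordProd l) = len (wordProd l) + 1 := by
      rw [← len_inv, mul_inv_rev, simple_inv, len_mul_simple hlt, len_inv]
    rw [List.map_cons, List.prod_cons, map_mul, Module.End.mul_apply, regRep_gen, ih (by omega),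
      leftOp_single, quadCoeff, if_pos hlt, zero_smul, add_zero, hcons]

end RegularRepresentation

/-! ### The standard basis -/

section StandardBasis

variable {n : ℕ}

/-- `H_i` for a natural number `i` (`1` unless `1 ≤ i ≤ n - 1`), the analogue of `simpleNat`. -/
noncomputable def genNat (n i : ℕ) : Hecke n :=
  if h : 1 ≤ i ∧ i < n then gen ⟨i, h⟩ else 1

theorem genNat_eq_gen {i : ℕ} (h : 1 ≤ i ∧ i < n) : genNat n i = gen ⟨i, h⟩ := dif_pos h

theorem genNat_comm {i j : ℕ} (h : i + 1 < j) : Commute (genNat n i) (genNat n j) := by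
  unfold genNat
  split_ifs with hi hj
  · exact gen_comm _ _ (by rw [lt_abs]; dsimp only; omega)
  all_goals simp

theorem genNat_braid {i : ℕ} (hi : 1 ≤ i) (hin : i + 1 < n) :
    genNat n (i + 1) * genNat n i * genNat n (i + 1)
      = genNat n i * genNat n (i + 1) * genNat n i := by
  rw [genNat_eq_gen ⟨hi, by omega⟩, genNat_eq_gen ⟨by omega, hin⟩]
  exact (gen_braid _ _ rfl).symm

theorem genNat_quad {i : ℕ} (h : 1 ≤ i ∧ i < n) :
    genNat n i * genNat n i = (v⁻¹ - v) • genNat n i + 1 := by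
  rw [genNat_eq_gen h, gen_quad]

/-- The descending product `H_j H_{j-1} ⋯ H_{j-q+1}`, the analogue of `tVee n (j + 1) q`. -/
noncomputable def descProd (n j q : ℕ) : Hecke n :=
  ((List.range q).map fun p => genNat n (j - p)).prod

@[simp] theorem descProd_zero (n j : ℕ) : descProd n j 0 = 1 := rfl

theorem descProd_succ (n j q : ℕ) : descProd n j (q + 1) = descProd n j q * genNat n (j - q) := by
  simp [descProd, List.range_succ]

theorem commute_descProd_genNat {j q i : ℕ} (h : q + i < j) :
    Commute (descProd n j q) (genNat n i) := by
  induction q with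
  | zero => exact Commute.one_left _
  | succ q ih =>
    rw [descProd_succ]
    exact (ih (by omega)).mul_left (genNat_comm (by omega)).symm

theorem descProd_succ_mul_genNat {j q : ℕ} (hq : q < j) (hj : j < n) :
    descProd n j (q + 1) * genNat n (j - q)
      = (v⁻¹ - v) • descProd n j (q + 1) + descProd n j q := by
  rw [descProd_succ, mul_assoc, genNat_quad ⟨by omega, by omega⟩, mul_add, mul_one, mul_smul_comm]

theorem descProd_mul_genNat_succ {j q i : ℕ} (hi : 1 ≤ i) (hij : i < j) (hjq : j < q + i)
    (hj : j < n) :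
    descProd n j q * genNat n (i + 1) = genNat n i * descProd n j q := by
  obtain ⟨r, rfl⟩ : ∃ r, j = i + 1 + r := ⟨j - (i + 1), by omega⟩
  induction q, (by omega : r + 2 ≤ q) using Nat.le_induction with
  | base =>
    rw [descProd_succ, descProd_succ, show i + 1 + r - r = i + 1 by omega,
      show i + 1 + r - (r + 1) = i by omega]
    calc descProd n (i + 1 + r) r * genNat n (i + 1) * genNat n i * genNat n (i + 1)
        = descProd n (i + 1 + r) r
            * (genNat n (i + 1) * genNat n i * genNat n (i + 1)) := by simp only [mul_assoc]
      _ = descProd n (i + 1 + r) r * genNat n i * (genNat n (i + 1) * genNat n i) := by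
          rw [genNat_braid hi (by omega)]; simp only [mul_assoc]
      _ = genNat n i * (descProd n (i + 1 + r) r * genNat n (i + 1) * genNat n i) := by
          rw [(commute_descProd_genNat (by omega)).eq]; simp only [mul_assoc]
  | succ q hq ih =>
    rw [descProd_succ, mul_assoc, (genNat_comm (by omega)).eq, ← mul_assoc, ih (by omega),
      mul_assoc]

/-- The span of the descending products starting with `H_j`, including the empty one. -/
noncomputable def descSpan (n j : ℕ) : Submodule K (Hecke n) :=
  Submodule.span K (descProd n j '' Set.Iic j)

/-- The span of the generators `H_1, …, H_{j-1}`. -/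
noncomputable def genSpan (n j : ℕ) : Submodule K (Hecke n) :=
  Submodule.span K (genNat n '' Set.Ico 1 j)

theorem descProd_mem_descSpan {j q : ℕ} (h : q ≤ j) : descProd n j q ∈ descSpan n j :=
  Submodule.subset_span ⟨q, h, rfl⟩

theorem genNat_mem_genSpan {i j : ℕ} (hi : 1 ≤ i) (hij : i < j) : genNat n i ∈ genSpan n j :=
  Submodule.subset_span ⟨i, ⟨hi, hij⟩, rfl⟩

theorem descSpan_mul_genSpan_le {j : ℕ} (hj : j < n) :
    descSpan n j * genSpan n (j + 1) ≤ descSpan n j ⊔ genSpan n j * descSpan n j := by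
  rw [descSpan, genSpan, Submodule.span_mul_span, Submodule.span_le]
  rintro _ ⟨_, ⟨q, hq : q ≤ j, rfl⟩, _, ⟨i, ⟨hi, hij⟩, rfl⟩, rfl⟩
  dsimp only
  rcases lt_trichotomy (q + i) j with h | h | h
  · rw [(commute_descProd_genNat h).eq]
    exact Submodule.mem_sup_right
      (Submodule.mul_mem_mul (genNat_mem_genSpan hi (by omega)) (descProd_mem_descSpan hq))
  · obtain rfl : i = j - q := by omega
    rw [← descProd_succ]
    exact Submodule.mem_sup_left (descProd_mem_descSpan (by omega))
  rcases (Nat.succ_le_of_lt h).eq_or_lt with h | h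
  · obtain ⟨q, rfl⟩ : ∃ p, q = p + 1 := ⟨q - 1, by omega⟩
    obtain rfl : i = j - q := by omega
    rw [descProd_succ_mul_genNat (by omega) hj]
    exact Submodule.mem_sup_left (add_mem (Submodule.smul_mem _ _ (descProd_mem_descSpan hq))
      (descProd_mem_descSpan (by omega)))
  · obtain ⟨i, rfl⟩ : ∃ p, i = p + 1 := ⟨i - 1, by omega⟩
    rw [descProd_mul_genNat_succ (by omega) (by omega) (by omega) hj]
    exact Submodule.mem_sup_right
      (Submodule.mul_mem_mul (genNat_mem_genSpan (by omega) (by omega)) (descProd_mem_descSpan hq))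

open scoped Pointwise Classical in
/-- The products `D_0 ⋯ D_{j-1}`, where `D_i` is a descending product starting with `H_i`. -/
noncomputable def normalForms (n : ℕ) : ℕ → Finset (Hecke n)
  | 0 => {1}
  | j + 1 => normalForms n j * (Finset.range (j + 1)).image (descProd n j)

theorem card_normalForms_le (n j : ℕ) : (normalForms n j).card ≤ j.factorial := by
  classical
  induction j with
  | zero => simp [normalForms]
  | succ j ih =>
    rw [normalForms, Nat.factorial_succ, mul_comm]
    exact Finset.card_mul_le.trans
      (Nat.mul_le_mul ih (Finset.card_image_le.trans (Finset.card_range _).le))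

theorem span_normalForms_succ (n j : ℕ) :
    Submodule.span K (normalForms n (j + 1) : Set (Hecke n))
      = Submodule.span K (normalForms n j : Set (Hecke n)) * descSpan n j := by
  classical
  rw [descSpan, Submodule.span_mul_span, normalForms, Finset.coe_mul, Finset.coe_image,
    Nat.range_succ_eq_Iic, Finset.coe_Iic]

theorem one_mem_span_normalForms (n j : ℕ) :
    (1 : Hecke n) ∈ Submodule.span K (normalForms n j : Set (Hecke n)) := by
  induction j with
  | zero => exact Submodule.subset_span (by simp [normalForms])
  | succ j ih =>
    rw [span_normalForms_succ, ← mul_one (1 : Hecke n)]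
    exact Submodule.mul_mem_mul ih (descProd_mem_descSpan (Nat.zero_le j))

theorem span_normalForms_mul_genSpan_le {j : ℕ} (hj : j ≤ n) :
    Submodule.span K (normalForms n j : Set (Hecke n)) * genSpan n j
      ≤ Submodule.span K (normalForms n j : Set (Hecke n)) := by
  induction j with
  | zero => simp [genSpan]
  | succ j ih =>
    set S := Submodule.span K (normalForms n j : Set (Hecke n))
    rw [span_normalForms_succ]
    calc S * descSpan n j * genSpan n (j + 1)
        = S * (descSpan n j * genSpan n (j + 1)) := mul_assoc _ _ _
      _ ≤ S * (descSpan n j ⊔ genSpan n j * descSpan n j) :=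
          mul_le_mul_right (descSpan_mul_genSpan_le hj) _
      _ = S * descSpan n j ⊔ S * genSpan n j * descSpan n j := by
          rw [Submodule.mul_sup, mul_assoc]
      _ ≤ S * descSpan n j :=
          sup_le le_rfl (mul_le_mul_left (ih (by omega)) _)

theorem adjoin_range_gen (n : ℕ) : Algebra.adjoin K (Set.range (gen (n := n))) = ⊤ := by
  have hrange : Set.range (gen (n := n)) = toHecke n '' Set.range (FreeAlgebra.ι K) := by
    rw [← Set.range_comp]; rfl
  rw [hrange, ← AlgHom.map_adjoin, FreeAlgebra.adjoin_range_ι, Algebra.map_top,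
    AlgHom.range_eq_top]
  exact RingQuot.mkAlgHom_surjective K _

theorem span_normalForms (n : ℕ) : Submodule.span K (normalForms n n : Set (Hecke n)) = ⊤ := by
  refine (Submodule.eq_top_iff').2 fun x => ?_
  have hx : x ∈ Algebra.adjoin K (Set.range (gen (n := n))) := adjoin_range_gen n ▸ trivial
  suffices h : ∀ y ∈ Submodule.span K (normalForms n n : Set (Hecke n)),
      y * x ∈ Submodule.span K (normalForms n n : Set (Hecke n)) by
    simpa using h 1 (one_mem_span_normalForms n n)
  induction hx using Algebra.adjoin_induction with
  | mem x hx =>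
    obtain ⟨i, rfl⟩ := hx
    rw [← genNat_eq_gen i.2]
    exact fun y hy => span_normalForms_mul_genSpan_le le_rfl
      (Submodule.mul_mem_mul hy (genNat_mem_genSpan i.2.1 i.2.2))
  | algebraMap c =>
    intro y hy
    rw [← Algebra.commutes, ← Algebra.smul_def]
    exact Submodule.smul_mem _ _ hy
  | add a b _ _ ha hb => exact fun y hy => mul_add y a b ▸ add_mem (ha y hy) (hb y hy)
  | mul a b _ _ ha hb => exact fun y hy => mul_assoc y a b ▸ hb _ (ha y hy)

/-- Evaluation of the regular representation at the basis vector standing for `H_e = 1`. -/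
noncomputable def orbitMap (n : ℕ) : Hecke n →ₗ[K] (Equiv.Perm (Fin n) →₀ K) :=
  (LinearMap.applyₗ (Finsupp.single 1 1)).comp (regRep n).toLinearMap

theorem orbitMap_genProd {w : Equiv.Perm (Fin n)} {l : List (SimpleIdx n)}
    (h : IsReducedWord l w) : orbitMap n (l.map gen).prod = Finsupp.single w 1 :=
  regRep_genProd_single_one h

theorem orbitMap_surjective (n : ℕ) : Function.Surjective (orbitMap n) := by
  rw [← LinearMap.range_eq_top, eq_top_iff, ← Finsupp.basisSingleOne.span_eq, Submodule.span_le]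
  rintro _ ⟨w, rfl⟩
  exact ⟨stdBasis w, by
    rw [Finsupp.coe_basisSingleOne]; exact orbitMap_genProd (exists_reducedWord w).choose_spec⟩

theorem orbitMap_injective (n : ℕ) : Function.Injective (orbitMap n) := by
  have hfin : Module.Finite K (Hecke n) := ⟨⟨normalForms n n, span_normalForms n⟩⟩
  have hle : Module.finrank K (Hecke n) ≤ n.factorial := by
    rw [← finrank_top, ← span_normalForms n]
    exact (finrank_span_finset_le_card _).trans (card_normalForms_le n n)
  have hcard : Module.finrank K (Equiv.Perm (Fin n) →₀ K) = n.factorial := by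
    rw [Module.finrank_finsupp_self, Fintype.card_perm, Fintype.card_fin]
  have hge := LinearMap.finrank_le_finrank_of_surjective (orbitMap_surjective n)
  exact (LinearMap.injective_iff_surjective_of_finrank_eq_finrank
    ((hle.trans hcard.ge).antisymm hge)).2 (orbitMap_surjective n)

/-- The basis of the Hecke algebra consisting of the `H_w`. -/
noncomputable def heckeBasis (n : ℕ) : Module.Basis (Equiv.Perm (Fin n)) K (Hecke n) :=
  ⟨LinearEquiv.ofBijective (orbitMap n) ⟨orbitMap_injective n, orbitMap_surjective n⟩⟩

theorem stdBasis_eq_genProd {w : Equiv.Perm (Fin n)} {l : List (SimpleIdx n)}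
    (h : IsReducedWord l w) : stdBasis w = (l.map gen).prod :=
  orbitMap_injective n
    ((orbitMap_genProd (exists_reducedWord w).choose_spec).trans (orbitMap_genProd h).symm)

@[simp] theorem heckeBasis_apply (w : Equiv.Perm (Fin n)) : heckeBasis n w = stdBasis w := by
  rw [← (heckeBasis n).repr.injective.eq_iff, Module.Basis.repr_self]
  exact (orbitMap_genProd (exists_reducedWord w).choose_spec).symm

@[simp] theorem stdBasis_one : stdBasis (1 : Equiv.Perm (Fin n)) = 1 :=
  stdBasis_eq_genProd (l := []) ⟨rfl, len_one.symm⟩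

theorem stdBasis_mul_simple {w : Equiv.Perm (Fin n)} {i : SimpleIdx n} (h : w i.lo < w i.hi) :
    stdBasis (w * simple i) = stdBasis w * gen i := by
  obtain ⟨l, hl, hlen⟩ := exists_reducedWord w
  have hreduced : IsReducedWord (l ++ [i]) (w * simple i) :=
    ⟨by rw [wordProd_append_singleton, hl], by
      rw [len_mul_simple h, List.length_append, hlen, List.length_singleton]⟩
  rw [stdBasis_eq_genProd ⟨hl, hlen⟩, stdBasis_eq_genProd hreduced, List.map_append,
    List.prod_append, List.map_singleton, List.prod_singleton]

theorem stdBasis_mul_gen_of_gt {w : Equiv.Perm (Fin n)} {i : SimpleIdx n} (h : w i.hi < w i.lo) :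
    stdBasis w * gen i = stdBasis (w * simple i) + (v⁻¹ - v) • stdBasis w := by
  have hw : stdBasis w = stdBasis (w * simple i) * gen i := by
    rw [← stdBasis_mul_simple (by simpa using h), mul_simple_mul_simple]
  conv_lhs => rw [hw]
  rw [mul_assoc, gen_quad, mul_add, mul_one, mul_smul_comm, ← hw, add_comm]

end StandardBasis

/-! ### Lattices and unitriangular families -/

section Lattice

variable {R M ι : Type*} [Ring R] [AddCommGroup M] [Module R M]

/-- The additive group of the linear combinations of the `b i`, `i ∈ S`, with coefficients in the
additive subgroup `A` of the ground ring. -/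
def lattice (A : AddSubgroup R) (b : ι → M) (S : Set ι) : AddSubgroup M :=
  AddSubgroup.closure (Set.image2 (fun a i => a • b i) (A : Set R) S)

variable {A : AddSubgroup R} {b : ι → M} {S : Set ι}

theorem smul_mem_lattice {a : R} {i : ι} (ha : a ∈ A) (hi : i ∈ S) : a • b i ∈ lattice A b S :=
  AddSubgroup.subset_closure ⟨a, ha, i, hi, rfl⟩

theorem lattice_le {N : AddSubgroup M} (h : ∀ a ∈ A, ∀ i ∈ S, a • b i ∈ N) :
    lattice A b S ≤ N := by
  rw [lattice, AddSubgroup.closure_le]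
  rintro _ ⟨a, ha, i, hi, rfl⟩
  exact h a ha i hi

theorem lattice_mono {T : Set ι} (h : S ⊆ T) : lattice A b S ≤ lattice A b T :=
  lattice_le fun _ ha _ hi => smul_mem_lattice ha (h hi)

theorem exists_sum_eq_of_mem_lattice {S : Finset ι} {x : M} (hx : x ∈ lattice A b S) :
    ∃ c : ι → R, (∀ i, c i ∈ A) ∧ x = ∑ i ∈ S, c i • b i := by
  classical
  rw [lattice] at hx
  induction hx using AddSubgroup.closure_induction with
  | mem x hx =>
    obtain ⟨a, ha, i, hi, rfl⟩ := hx
    refine ⟨Pi.single i a, fun j => ?_, ?_⟩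
    · obtain rfl | hij := eq_or_ne j i
      · rwa [Pi.single_eq_same]
      · rw [Pi.single_eq_of_ne hij]; exact zero_mem A
    · rw [Finset.sum_eq_single_of_mem i hi fun j _ hij => by rw [Pi.single_eq_of_ne hij, zero_smul],
        Pi.single_eq_same]
  | zero => exact ⟨0, fun _ => zero_mem A, by simp⟩
  | add x y _ _ hx hy =>
    obtain ⟨c, hc, rfl⟩ := hx
    obtain ⟨d, hd, rfl⟩ := hy
    exact ⟨c + d, fun i => add_mem (hc i) (hd i), by
      simp only [Pi.add_apply, add_smul, Finset.sum_add_distrib]⟩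
  | neg x _ hx =>
    obtain ⟨c, hc, rfl⟩ := hx
    exact ⟨-c, fun i => neg_mem (hc i), by
      simp only [Pi.neg_apply, neg_smul, Finset.sum_neg_distrib]⟩

theorem smul_mem_lattice_of_unitriangular {r : ι → ι → Prop} (hr : WellFounded r)
    {I : AddSubgroup R} (hAI : ∀ a ∈ A, ∀ p ∈ I, a * p ∈ A) {c : ι → M}
    (hc : ∀ i, c i - b i ∈ lattice I b {j | r j i}) {a : R} (ha : a ∈ A) (i : ι) :
    a • b i ∈ lattice A c Set.univ := by
  induction i using hr.induction generalizing a with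
  | h i ih =>
    have hle : lattice I b {j | r j i}
        ≤ (lattice A c Set.univ).comap (DistribSMul.toAddMonoidHom M a) :=
      lattice_le fun p hp j hj => by
        simpa only [AddSubgroup.mem_comap, DistribSMul.toAddMonoidHom_apply, smul_smul]
          using ih j hj (hAI a ha p hp)
    rw [← sub_sub_cancel (c i) (b i), smul_sub]
    exact sub_mem (smul_mem_lattice ha trivial) (hle (hc i))

end Lattice

/-! ### Integral polynomials in `v` -/

section Coefficients

/-- The subring `ℤ[v]` of `ℂ(v)`. -/
noncomputable def intPoly : Subring K := (Polynomial.aeval (R := ℤ) v).toRingHom.range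

/-- The additive group `v ℤ[v]`. -/
noncomputable def vIntPoly : AddSubgroup K :=
  (Ideal.span {(Polynomial.X : Polynomial ℤ)}).toAddSubgroup.map
    (Polynomial.aeval (R := ℤ) v).toRingHom.toAddMonoidHom

theorem mem_vIntPoly {a : K} :
    a ∈ vIntPoly ↔ ∃ P : Polynomial ℤ, Polynomial.X ∣ P ∧ Polynomial.aeval v P = a := by
  simp only [vIntPoly, AddSubgroup.mem_map, Submodule.mem_toAddSubgroup,
    Ideal.mem_span_singleton]
  rfl

theorem v_mul_mem_vIntPoly {a : K} (ha : a ∈ intPoly) : v * a ∈ vIntPoly := by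
  obtain ⟨P, rfl⟩ := ha
  exact mem_vIntPoly.2 ⟨Polynomial.X * P, dvd_mul_right _ _, by
    rw [map_mul, Polynomial.aeval_X]; rfl⟩

theorem exists_v_mul_eq_of_mem_vIntPoly {a : K} (ha : a ∈ vIntPoly) :
    ∃ b ∈ intPoly, v * b = a := by
  obtain ⟨_, ⟨P, rfl⟩, rfl⟩ := mem_vIntPoly.1 ha
  exact ⟨Polynomial.aeval v P, ⟨P, rfl⟩, by rw [map_mul, Polynomial.aeval_X]⟩

theorem v_mem_intPoly : v ∈ intPoly := ⟨Polynomial.X, Polynomial.aeval_X _⟩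

theorem v_pow_mem_vIntPoly {m : ℕ} (hm : 0 < m) : v ^ m ∈ vIntPoly := by
  rw [← Nat.sub_add_cancel hm, pow_succ']
  exact v_mul_mem_vIntPoly (pow_mem v_mem_intPoly _)

theorem vIntPoly_le_intPoly : vIntPoly ≤ intPoly.toAddSubgroup := fun a ha => by
  obtain ⟨b, hb, rfl⟩ := exists_v_mul_eq_of_mem_vIntPoly ha
  exact intPoly.mul_mem v_mem_intPoly hb

theorem mul_mem_vIntPoly {a b : K} (ha : a ∈ vIntPoly) (hb : b ∈ intPoly) :
    a * b ∈ vIntPoly := by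
  obtain ⟨c, hc, rfl⟩ := exists_v_mul_eq_of_mem_vIntPoly ha
  rw [mul_assoc]
  exact v_mul_mem_vIntPoly (mul_mem hc hb)

theorem mul_v_inv_mem_intPoly {a : K} (ha : a ∈ vIntPoly) : a * v⁻¹ ∈ intPoly := by
  obtain ⟨b, hb, rfl⟩ := exists_v_mul_eq_of_mem_vIntPoly ha
  rwa [mul_comm, inv_mul_cancel_left₀ v_ne_zero]

theorem exists_int_sub_mem_vIntPoly {a : K} (ha : a ∈ intPoly) :
    ∃ m : ℤ, a - (m : K) ∈ vIntPoly := by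
  obtain ⟨P, rfl⟩ := ha
  refine ⟨P.coeff 0, mem_vIntPoly.2 ⟨P - Polynomial.C (P.coeff 0), ?_, ?_⟩⟩
  · rw [Polynomial.X_dvd_iff, Polynomial.coeff_sub, Polynomial.coeff_C_zero, sub_self]
  · rw [map_sub, Polynomial.aeval_C, eq_intCast]; rfl

theorem transcendental_int_v : Transcendental ℤ (v : K) := by
  have h : Transcendental ℂ (v : K) := fun h => transcendental_v_inv h.inv
  exact h.restrictScalars (RingHom.injective_int (algebraMap ℤ ℂ))

theorem conj_aeval_v (P : Polynomial ℤ) :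
    conj (Polynomial.aeval v P) = Polynomial.aeval (v⁻¹ : K) P := by
  rw [← conj_v]
  exact (Polynomial.aeval_algHom_apply (conj.restrictScalars ℤ) v P).symm

theorem aeval_v_reverse (P : Polynomial ℤ) :
    Polynomial.aeval (v : K) P.reverse = Polynomial.aeval (v⁻¹ : K) P * v ^ P.natDegree := by
  have hinv : Invertible (v⁻¹ : K) := invertibleOfNonzero (inv_ne_zero v_ne_zero)
  have h := Polynomial.eval₂_reverse_mul_pow (algebraMap ℤ K) (v⁻¹ : K) P
  rw [invOf_eq_inv, inv_inv] at h
  rw [Polynomial.aeval_def, Polynomial.aeval_def, ← h, mul_assoc, ← mul_pow,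
    inv_mul_cancel₀ v_ne_zero, one_pow, mul_one]

theorem eq_zero_of_conj_eq {a : K} (ha : a ∈ vIntPoly) (hc : conj a = a) : a = 0 := by
  obtain ⟨P, hP, rfl⟩ := mem_vIntPoly.1 ha
  have hreverse : P.reverse = P * Polynomial.X ^ P.natDegree := by
    refine transcendental_iff_injective.1 transcendental_int_v ?_
    rw [aeval_v_reverse, ← conj_aeval_v, hc, map_mul, map_pow, Polynomial.aeval_X]
  have hlead : P.leadingCoeff = 0 := by
    rw [← Polynomial.coeff_zero_reverse, hreverse, Polynomial.mul_coeff_zero,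
      Polynomial.X_dvd_iff.1 hP, zero_mul]
  rw [Polynomial.leadingCoeff_eq_zero.1 hlead, map_zero]

end Coefficients

/-! ### The Kazhdan–Lusztig basis -/

section KazhdanLusztig

variable {n : ℕ}

theorem bar_smul (c : K) (x : Hecke n) : bar n (c • x) = conj c • bar n x := by
  rw [Algebra.smul_def, map_mul, bar_algebraMap, ← Algebra.smul_def]

theorem bar_gen_add_v (i : SimpleIdx n) : bar n (gen i + v • 1) = gen i + v • 1 := by
  rw [map_add, bar_gen, bar_smul, conj_v, map_one, genInv, add_assoc, ← add_smul, sub_add_cancel]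

theorem stdBasis_mul_gen_add_v_of_lt {w : Equiv.Perm (Fin n)} {i : SimpleIdx n}
    (h : w i.lo < w i.hi) :
    stdBasis w * (gen i + v • 1) = stdBasis (w * simple i) + v • stdBasis w := by
  rw [mul_add, ← stdBasis_mul_simple h, mul_smul_comm, mul_one]

theorem stdBasis_mul_gen_add_v_of_gt {w : Equiv.Perm (Fin n)} {i : SimpleIdx n}
    (h : w i.hi < w i.lo) :
    stdBasis w * (gen i + v • 1) = stdBasis (w * simple i) + v⁻¹ • stdBasis w := by
  rw [mul_add, stdBasis_mul_gen_of_gt h, mul_smul_comm, mul_one, add_assoc, ← add_smul,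
    sub_add_cancel]

/-- The combinations of the `H_y` with `y ≺ w` and coefficients in `A`. -/
noncomputable def lowerLattice (A : AddSubgroup K) (w : Equiv.Perm (Fin n)) :
    AddSubgroup (Hecke n) :=
  lattice A stdBasis {y | BruhatLT y w}

/-- The defining properties of the Kazhdan–Lusztig element `C_w`. -/
structure IsKLElement (w : Equiv.Perm (Fin n)) (x : Hecke n) : Prop where
  bar_eq : bar n x = x
  sub_mem : x - stdBasis w ∈ lowerLattice vIntPoly w

theorem lowerLattice_mono {A : AddSubgroup K} {y w : Equiv.Perm (Fin n)} (h : BruhatLT y w) :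
    lowerLattice A y ≤ lowerLattice A w :=
  lattice_mono fun _ hz => BruhatLT.trans hz h

theorem smul_stdBasis_mul_mem_lowerLattice {y w : Equiv.Perm (Fin n)} {i : SimpleIdx n} {p : K}
    (hp : p ∈ vIntPoly) (hy : BruhatLT y w) (hyi : BruhatLT (y * simple i) w) :
    p • stdBasis y * (gen i + v • 1) ∈ lowerLattice intPoly.toAddSubgroup w := by
  rw [smul_mul_assoc]
  rcases apply_lo_lt_or_gt y i with h | h
  · rw [stdBasis_mul_gen_add_v_of_lt h, smul_add, smul_smul]
    exact add_mem (smul_mem_lattice (vIntPoly_le_intPoly hp) hyi)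
      (smul_mem_lattice (vIntPoly_le_intPoly (mul_mem_vIntPoly hp v_mem_intPoly)) hy)
  · rw [stdBasis_mul_gen_add_v_of_gt h, smul_add, smul_smul]
    exact add_mem (smul_mem_lattice (vIntPoly_le_intPoly hp) hyi)
      (smul_mem_lattice (mul_v_inv_mem_intPoly hp) hy)

theorem IsKLElement.mul_gen_add_v_sub_mem {u : Equiv.Perm (Fin n)} {x : Hecke n} {i : SimpleIdx n}
    (hx : IsKLElement u x) (hu : u i.lo < u i.hi) :
    x * (gen i + v • 1) - stdBasis (u * simple i)
      ∈ lowerLattice intPoly.toAddSubgroup (u * simple i) := by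
  have hle : lowerLattice vIntPoly u ≤ (lowerLattice intPoly.toAddSubgroup (u * simple i)).comap
      (AddMonoidHom.mulRight (gen i + v • 1)) :=
    lattice_le fun p hp y hy =>
      smul_stdBasis_mul_mem_lowerLattice hp (BruhatLT.trans hy (bruhatLT_mul_simple hu))
        (BruhatLT.mul_simple hy hu)
  have heq : x * (gen i + v • 1) - stdBasis (u * simple i)
      = (x - stdBasis u) * (gen i + v • 1) + v • stdBasis u := by
    rw [sub_mul, stdBasis_mul_gen_add_v_of_lt hu]; abel
  rw [heq]
  exact add_mem (hle hx.sub_mem) (smul_mem_lattice v_mem_intPoly (bruhatLT_mul_simple hu))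

theorem exists_bar_eq_sub_mem {w : Equiv.Perm (Fin n)}
    (hw : ∀ y, BruhatLT y w → ∃ c, IsKLElement y c) {x : Hecke n}
    (hx : x ∈ lowerLattice intPoly.toAddSubgroup w) :
    ∃ c, bar n c = c ∧ x - c ∈ lowerLattice vIntPoly w := by
  rw [lowerLattice, lattice] at hx
  induction hx using AddSubgroup.closure_induction with
  | mem x hx =>
    obtain ⟨p, hp, y, hy, rfl⟩ := hx
    obtain ⟨m, hm⟩ := exists_int_sub_mem_vIntPoly hp
    obtain ⟨c, hc⟩ := hw y hy
    refine ⟨m • c, by rw [map_zsmul, hc.bar_eq], ?_⟩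
    have heq : p • stdBasis y - m • c = (p - (m : K)) • stdBasis y - m • (c - stdBasis y) := by
      rw [sub_smul, Int.cast_smul_eq_zsmul, smul_sub]; abel
    dsimp only
    rw [heq]
    exact sub_mem (smul_mem_lattice hm hy) (zsmul_mem (lowerLattice_mono hy hc.sub_mem) m)
  | zero => exact ⟨0, map_zero _, by rw [sub_zero]; exact zero_mem _⟩
  | add x y _ _ hx hy =>
    obtain ⟨c, hc, hxc⟩ := hx
    obtain ⟨d, hd, hyd⟩ := hy
    exact ⟨c + d, by rw [map_add, hc, hd], by rw [add_sub_add_comm]; exact add_mem hxc hyd⟩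
  | neg x _ hx =>
    obtain ⟨c, hc, hxc⟩ := hx
    exact ⟨-c, by rw [map_neg, hc], by rw [neg_sub_neg, ← neg_sub]; exact neg_mem hxc⟩

theorem wellFounded_bruhatLT (n : ℕ) :
    WellFounded (BruhatLT : Equiv.Perm (Fin n) → Equiv.Perm (Fin n) → Prop) :=
  Subrelation.wf BruhatLT.len_lt (measure len).wf

theorem exists_isKLElement (w : Equiv.Perm (Fin n)) : ∃ x, IsKLElement w x := by
  induction w using (wellFounded_bruhatLT n).induction with
  | h w ih =>
    by_cases hw : w = 1
    · subst hw
      exact ⟨1, map_one _, by rw [stdBasis_one, sub_self]; exact zero_mem _⟩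
    obtain ⟨i, hi⟩ := exists_descent hw
    have hu : (w * simple i) i.lo < (w * simple i) i.hi := by simpa using hi
    obtain ⟨x, hx⟩ := ih (w * simple i) (by simpa using bruhatLT_mul_simple hu)
    have hmem := hx.mul_gen_add_v_sub_mem hu
    rw [mul_simple_mul_simple] at hmem
    obtain ⟨c, hc, hxc⟩ := exists_bar_eq_sub_mem ih hmem
    exact ⟨x * (gen i + v • 1) - c, by rw [map_sub, map_mul, hx.bar_eq, bar_gen_add_v, hc],
      by rwa [sub_right_comm]⟩

theorem isKLBasis_of_isKLElement {C : Equiv.Perm (Fin n) → Hecke n}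
    (hC : ∀ w, IsKLElement w (C w)) : IsKLBasis n C := by
  classical
  have hspan : Submodule.span K (Set.range C) = ⊤ := by
    have hle : lattice ⊤ C Set.univ ≤ (Submodule.span K (Set.range C)).toAddSubgroup :=
      lattice_le fun a _ w _ => Submodule.smul_mem _ a (Submodule.subset_span ⟨w, rfl⟩)
    rw [eq_top_iff, ← (heckeBasis n).span_eq, Submodule.span_le]
    rintro _ ⟨w, rfl⟩
    rw [heckeBasis_apply, ← one_smul K (stdBasis w)]
    exact hle (smul_mem_lattice_of_unitriangular (wellFounded_bruhatLT n)
      (fun _ _ _ _ => AddSubgroup.mem_top _) (fun w => (hC w).sub_mem) (AddSubgroup.mem_top 1) w)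
  refine ⟨linearIndependent_of_top_le_span_of_card_eq_finrank hspan.ge
    (Module.finrank_eq_card_basis (heckeBasis n)).symm, hspan, fun w => (hC w).bar_eq, fun w => ?_⟩
  obtain ⟨c, hc, hsum⟩ := exists_sum_eq_of_mem_lattice
    (S := Finset.univ.filter fun y => BruhatLT y w) (by
      simpa [lowerLattice] using (hC w).sub_mem)
  choose P hP hPc using fun y => mem_vIntPoly.1 (hc y)
  refine ⟨P, fun y _ => hP y, ?_⟩
  simp only [hPc, ← hsum, add_sub_cancel]

theorem isKLBasis_klBasis (n : ℕ) : IsKLBasis n klBasis := by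
  choose C hC using exists_isKLElement (n := n)
  exact Classical.epsilon_spec ⟨C, isKLBasis_of_isKLElement hC⟩

theorem IsKLBasis.isKLElement {C : Equiv.Perm (Fin n) → Hecke n} (hC : IsKLBasis n C)
    (w : Equiv.Perm (Fin n)) : IsKLElement w (C w) := by
  classical
  obtain ⟨P, hP, hw⟩ := hC.unitriangular w
  refine ⟨hC.bar_invariant w, ?_⟩
  rw [hw, add_sub_cancel_left]
  refine sum_mem fun y hy => ?_
  have hyw := (Finset.mem_filter.1 hy).2
  exact smul_mem_lattice (mem_vIntPoly.2 ⟨P y, hP y hyw, rfl⟩) hyw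

theorem eq_zero_of_bar_eq {x : Hecke n} (hx : bar n x = x)
    (hmem : x ∈ lattice vIntPoly stdBasis Set.univ) : x = 0 := by
  classical
  have hle : lattice vIntPoly stdBasis Set.univ
      ≤ lattice vIntPoly (klBasis (n := n)) Set.univ :=
    lattice_le fun a ha w _ => smul_mem_lattice_of_unitriangular (wellFounded_bruhatLT n)
      (fun _ ha _ hp => mul_mem_vIntPoly ha (vIntPoly_le_intPoly hp))
      (fun w => ((isKLBasis_klBasis n).isKLElement w).sub_mem) ha w
  obtain ⟨c, hc, rfl⟩ := exists_sum_eq_of_mem_lattice (S := Finset.univ)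
    (by simpa using hle hmem)
  have hzero : ∑ w, (conj (c w) - c w) • klBasis w = 0 := by
    simp only [map_sum, bar_smul, (isKLBasis_klBasis n).bar_invariant] at hx
    simp only [sub_smul, Finset.sum_sub_distrib, hx, sub_self]
  have hconj := Fintype.linearIndependent_iff.1 (isKLBasis_klBasis n).linearIndependent _ hzero
  exact Finset.sum_eq_zero fun w _ => by
    rw [eq_zero_of_conj_eq (hc w) (sub_eq_zero.1 (hconj w)), zero_smul]

theorem klBasis_eq_of_bar_eq {w : Equiv.Perm (Fin n)} {x : Hecke n} (hx : bar n x = x)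
    (hmem : x - stdBasis w ∈ lattice vIntPoly stdBasis Set.univ) : klBasis w = x := by
  have hw := (isKLBasis_klBasis n).isKLElement w
  rw [← sub_eq_zero]
  refine eq_zero_of_bar_eq (by rw [map_sub, hw.bar_eq, hx]) ?_
  rw [← sub_sub_sub_cancel_right _ _ (stdBasis w)]
  exact sub_mem (lattice_mono (Set.subset_univ _) hw.sub_mem) hmem

end KazhdanLusztig

/-! ### Products of the sums `∑_q v^{l-q} H_j ⋯ H_{j-q+1}` -/

section DescSum

variable {n : ℕ}

/-- The sum `∑_{q ≤ l} v^{l-q} H_j H_{j-1} ⋯ H_{j-q+1}`, the factor that the index `i_{j+1}`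
contributes to the Kazhdan–Lusztig element. -/
noncomputable def descSum (n j l : ℕ) : Hecke n :=
  ∑ q ∈ Finset.range (l + 1), v ^ (l - q) • descProd n j q

theorem descSum_zero (n j : ℕ) : descSum n j 0 = 1 := by simp [descSum]

theorem descSum_succ (n j l : ℕ) :
    descSum n j (l + 1) = v • descSum n j l + descProd n j (l + 1) := by
  rw [descSum, Finset.sum_range_succ, Nat.sub_self, pow_zero, one_smul, descSum, Finset.smul_sum]
  congr 1
  refine Finset.sum_congr rfl fun q hq => ?_
  rw [smul_smul, ← pow_succ', ← Nat.sub_add_comm (Finset.mem_range_succ_iff.1 hq)]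

theorem descSum_one (n j : ℕ) : descSum n j 1 = genNat n j + v • 1 := by
  rw [descSum_succ, descSum_zero, descProd_succ, descProd_zero, one_mul, Nat.sub_zero, add_comm]

theorem commute_descSum_genNat {j l i : ℕ} (h : l + i < j) :
    Commute (descSum n j l) (genNat n i) :=
  Commute.sum_left _ _ _ fun q hq => by
    have hql := Finset.mem_range.1 hq
    exact (commute_descProd_genNat (by omega)).smul_left _

theorem descProd_add_mul_genNat {j l : ℕ} (hl : l < j) (hj : j < n) :
    (v • descProd n j l + descProd n j (l + 1)) * genNat n (j - l)
      = v⁻¹ • (v • descProd n j l + descProd n j (l + 1)) := by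
  rw [add_mul, descProd_succ_mul_genNat hl hj, smul_mul_assoc, ← descProd_succ, smul_add,
    smul_smul v⁻¹ v, inv_mul_cancel₀ v_ne_zero, one_smul, sub_smul]
  abel

variable {j : ℕ} {x : Hecke n}

theorem mul_descSum_succ_mul_genNat {l : ℕ} (hl : l < j) (hj : j < n)
    (hx : 0 < l → x * genNat n (j - l) = v⁻¹ • x) :
    x * descSum n j (l + 1) * genNat n (j - l) = v⁻¹ • (x * descSum n j (l + 1)) := by
  have htop := descProd_add_mul_genNat hl hj
  cases l with
  | zero =>
    rw [descSum_succ, descSum_zero, ← descProd_zero n j, mul_assoc, htop, mul_smul_comm]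
  | succ l =>
    have hlow : x * descSum n j l * genNat n (j - (l + 1)) = v⁻¹ • (x * descSum n j l) := by
      rw [mul_assoc, (commute_descSum_genNat (by omega)).eq, ← mul_assoc, hx (by omega),
        smul_mul_assoc]
    have hsplit : descSum n j (l + 1 + 1) = (v * v) • descSum n j l
        + (v • descProd n j (l + 1) + descProd n j (l + 1 + 1)) := by
      rw [descSum_succ, descSum_succ, smul_add, smul_smul, add_assoc]
    rw [hsplit, mul_add, add_mul, mul_assoc x (v • _ + _), htop, mul_smul_comm (v * v),
      smul_mul_assoc, hlow, mul_smul_comm, smul_add, smul_comm (v * v)]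

theorem mul_descSum_mul_genNat {l i : ℕ} (hl : l ≤ j) (hj : j < n)
    (hx : ∀ i, 1 ≤ i → j < l + i → i < j → x * genNat n i = v⁻¹ • x) (hi : 1 ≤ i)
    (hli : j < l + i) (hij : i ≤ j) :
    x * descSum n j l * genNat n i = v⁻¹ • (x * descSum n j l) := by
  induction l with
  | zero => omega
  | succ l ih =>
    rcases (Nat.succ_le_of_lt hli).eq_or_lt with h | h
    · obtain rfl : i = j - l := by omega
      exact mul_descSum_succ_mul_genNat hl hj fun _ => hx _ hi hli (by omega)
    · obtain ⟨i, rfl⟩ : ∃ p, i = p + 1 := ⟨i - 1, by omega⟩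
      rw [descSum_succ, mul_add, mul_smul_comm, add_mul, smul_mul_assoc,
        ih (by omega) (fun i hi hli hij => hx i hi (by omega) hij) (by omega), mul_assoc x,
        descProd_mul_genNat_succ (by omega) (by omega) (by omega) hj, ← mul_assoc,
        hx i (by omega) (by omega) (by omega), smul_mul_assoc, smul_add, smul_comm v]

theorem mul_descSum_add_two {l : ℕ} (hl : l + 1 < j)
    (hx : x * genNat n (j - (l + 1)) = v⁻¹ • x) :
    x * descSum n j (l + 2) = x * descSum n j (l + 1) * (genNat n (j - (l + 1)) + v • 1)
      - x * descSum n j l := by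
  have hmul : x * descSum n j (l + 1) * genNat n (j - (l + 1))
      = x * descSum n j l + x * descProd n j (l + 2) := by
    rw [mul_assoc, descSum_succ, add_mul, ← descProd_succ, smul_mul_assoc,
      (commute_descSum_genNat (by omega)).eq, mul_add, mul_smul_comm, ← mul_assoc, hx,
      smul_mul_assoc, smul_smul, mul_inv_cancel₀ v_ne_zero, one_smul]
  rw [mul_add, hmul, mul_smul_comm, mul_one, descSum_succ n j (l + 1), mul_add, mul_smul_comm]
  abel

theorem bar_genNat_add_v {i : ℕ} (h : 1 ≤ i ∧ i < n) :
    bar n (genNat n i + v • 1) = genNat n i + v • 1 := by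
  rw [genNat_eq_gen h, bar_gen_add_v]

theorem bar_mul_descSum {l : ℕ} (hl : l ≤ j) (hj : j < n) (hbar : bar n x = x)
    (hx : ∀ i, 1 ≤ i → j < l + i → i < j → x * genNat n i = v⁻¹ • x) :
    bar n (x * descSum n j l) = x * descSum n j l := by
  induction l using Nat.twoStepInduction with
  | zero => rw [descSum_zero, mul_one, hbar]
  | one => rw [map_mul, hbar, descSum_one, bar_genNat_add_v ⟨hl, hj⟩]
  | more l ih₀ ih₁ =>
    rw [mul_descSum_add_two hl (hx _ (by omega) (by omega) (by omega)), map_sub, map_mul,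
      bar_genNat_add_v ⟨by omega, by omega⟩,
      ih₀ (by omega) fun i hi hli hij => hx i hi (by omega) hij,
      ih₁ (by omega) fun i hi hli hij => hx i hi (by omega) hij]

/-- The product of the sums `descSum n j (a j)` for `j = 0, 1, …, m - 1`. -/
noncomputable def descSumProd (n : ℕ) {m : ℕ} (a : Fin m → ℕ) : Hecke n :=
  (List.ofFn fun j => descSum n j (a j)).prod

theorem descSumProd_succ {m : ℕ} (a : Fin (m + 1) → ℕ) :
    descSumProd n a = descSumProd n (Fin.init a) * descSum n m (a (Fin.last m)) := by
  rw [descSumProd, List.ofFn_succ', List.prod_concat]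
  rfl

theorem init_apply_le {m : ℕ} {a : Fin (m + 1) → ℕ} (ha : ∀ j, a j ≤ j) (j : Fin m) :
    Fin.init a j ≤ j :=
  ha j.castSucc

theorem monotone_init_sub {m : ℕ} {a : Fin (m + 1) → ℕ}
    (ha : Monotone fun j : Fin (m + 1) => (j : ℕ) - a j) :
    Monotone fun j : Fin m => (j : ℕ) - Fin.init a j :=
  ha.comp Fin.strictMono_castSucc.monotone

theorem descSumProd_mul_genNat {m : ℕ} (hm : m ≤ n) {a : Fin m → ℕ} (ha : ∀ j, a j ≤ j)
    (hmono : Monotone fun j : Fin m => (j : ℕ) - a j) {i : ℕ} (hi : 1 ≤ i) (him : i < m)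
    (hai : ∀ j : Fin m, (j : ℕ) - a j < i) :
    descSumProd n a * genNat n i = v⁻¹ • descSumProd n a := by
  induction m generalizing i with
  | zero => omega
  | succ m ih =>
    have hlast : a (Fin.last m) ≤ m := ha (Fin.last m)
    have hai' : m - a (Fin.last m) < i := hai (Fin.last m)
    rw [descSumProd_succ]
    refine mul_descSum_mul_genNat hlast hm (fun i' hi' hli hij => ?_) hi (by omega) (by omega)
    exact ih (by omega) (init_apply_le ha) (monotone_init_sub hmono) hi' hij fun j =>
      (hmono (Fin.le_last j.castSucc)).trans_lt (by dsimp only [Fin.val_last]; omega)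

theorem bar_descSumProd {m : ℕ} (hm : m ≤ n) {a : Fin m → ℕ} (ha : ∀ j, a j ≤ j)
    (hmono : Monotone fun j : Fin m => (j : ℕ) - a j) :
    bar n (descSumProd n a) = descSumProd n a := by
  induction m with
  | zero => exact map_one (bar n)
  | succ m ih =>
    have hlast : a (Fin.last m) ≤ m := ha (Fin.last m)
    rw [descSumProd_succ]
    refine bar_mul_descSum hlast hm (ih (by omega) (init_apply_le ha) (monotone_init_sub hmono))
      fun i hi hli him => ?_
    exact descSumProd_mul_genNat (by omega) (init_apply_le ha) (monotone_init_sub hmono) hi him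
      fun j => (hmono (Fin.le_last j.castSucc)).trans_lt (by dsimp only [Fin.val_last]; omega)

end DescSum

/-! ### The normal form of a permutation as a product of the elements `t^∨` -/

section Code

variable {n : ℕ}

theorem simpleNat_eq_simple {i : ℕ} (h : 1 ≤ i ∧ i < n) : simpleNat n i = simple ⟨i, h⟩ :=
  dif_pos h

theorem simpleNat_apply_of_ne {i : ℕ} {x : Fin n} (hlo : x.1 + 1 ≠ i) (hhi : x.1 ≠ i) :
    simpleNat n i x = x := by
  unfold simpleNat
  split_ifs with h
  · exact simple_apply_of_ne (fun hx => hlo (by rw [hx]; exact Nat.sub_add_cancel h.1))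
      fun hx => hhi (congrArg Fin.val hx)
  · rfl

theorem tVee_succ (n j l : ℕ) :
    tVee n (j + 1) (l + 1) = tVee n (j + 1) l * simpleNat n (j - l) := by
  simp [tVee, List.range_succ]

theorem tVee_apply_of_lt {j l : ℕ} {x : Fin n} (h : x.1 + l < j) : tVee n (j + 1) l x = x := by
  induction l with
  | zero => rfl
  | succ l ih =>
    rw [tVee_succ, Equiv.Perm.mul_apply, simpleNat_apply_of_ne (by omega) (by omega),
      ih (by omega)]

theorem tVee_apply_of_gt {j l : ℕ} {x : Fin n} (h : j < x.1) : tVee n (j + 1) l x = x := by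
  induction l with
  | zero => rfl
  | succ l ih =>
    rw [tVee_succ, Equiv.Perm.mul_apply, simpleNat_apply_of_ne (by omega) (by omega), ih]

theorem tVee_apply_of_add_eq {j l : ℕ} (hj : j < n) {x : Fin n} (h : x.1 + l = j) :
    tVee n (j + 1) l x = ⟨j, hj⟩ := by
  induction l generalizing x with
  | zero => exact Fin.ext h
  | succ l ih =>
    have hi : 1 ≤ j - l ∧ j - l < n := by omega
    obtain rfl : x = SimpleIdx.lo ⟨j - l, hi⟩ := Fin.ext (show x.1 = j - l - 1 by omega)
    rw [tVee_succ, Equiv.Perm.mul_apply, simpleNat_eq_simple hi, simple_lo]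
    exact ih (show j - l + l = j by omega)

theorem parabolic_mono {j k : ℕ} (h : j ≤ k) : parabolic n j ≤ parabolic n k :=
  Subgroup.closure_mono fun _ ⟨i, hi, hs⟩ => ⟨i, hi.trans_le h, hs⟩

theorem simpleNat_mem_parabolic {i k : ℕ} (h : i < k) : simpleNat n i ∈ parabolic n k := by
  unfold simpleNat
  split_ifs with hi
  · exact Subgroup.subset_closure ⟨⟨i, hi⟩, h, rfl⟩
  · exact one_mem _

theorem tVee_mem_parabolic (n j l : ℕ) : tVee n (j + 1) l ∈ parabolic n (j + 1) := by
  induction l with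
  | zero => exact one_mem _
  | succ l ih =>
    rw [tVee_succ]
    exact mul_mem ih (simpleNat_mem_parabolic (by omega))

theorem apply_eq_of_mem_parabolic {k : ℕ} {w : Equiv.Perm (Fin n)} (hw : w ∈ parabolic n k)
    {x : Fin n} (hx : k ≤ x.1) : w x = x := by
  induction hw using Subgroup.closure_induction with
  | mem _ h =>
    obtain ⟨i, hi, rfl⟩ := h
    rw [← simpleNat_eq_simple i.2, simpleNat_apply_of_ne (by omega) (by omega)]
  | one => rfl
  | mul u w _ _ hu hw => rw [Equiv.Perm.mul_apply, hw, hu]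
  | inv w _ hw => rw [Equiv.Perm.inv_eq_iff_eq, hw]

theorem apply_lt_of_mem_parabolic {k : ℕ} {w : Equiv.Perm (Fin n)} (hw : w ∈ parabolic n k)
    {x : Fin n} (hx : x.1 < k) : (w x).1 < k := by
  by_contra! h
  rw [w.injective (apply_eq_of_mem_parabolic hw h)] at h
  exact hx.not_ge h

theorem mul_tVee_lo_lt_hi {j l : ℕ} (hj : j < n) (hl : l < j) {w : Equiv.Perm (Fin n)}
    (hw : w ∈ parabolic n j) {i : SimpleIdx n} (hi : i.1 = j - l) :
    (w * tVee n (j + 1) l) i.lo < (w * tVee n (j + 1) l) i.hi := by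
  have hlo : i.lo.1 = i.1 - 1 := rfl
  have hhi : i.hi.1 = i.1 := rfl
  rw [Equiv.Perm.mul_apply, Equiv.Perm.mul_apply, tVee_apply_of_lt (x := i.lo) (by omega),
    tVee_apply_of_add_eq hj (x := i.hi) (by omega),
    apply_eq_of_mem_parabolic hw (x := ⟨j, hj⟩) le_rfl]
  exact apply_lt_of_mem_parabolic hw (by omega)

theorem len_mul_tVee {j l : ℕ} (hj : j < n) (hl : l ≤ j) {w : Equiv.Perm (Fin n)}
    (hw : w ∈ parabolic n j) : len (w * tVee n (j + 1) l) = len w + l := by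
  induction l with
  | zero => rfl
  | succ l ih =>
    have hi : 1 ≤ j - l ∧ j - l < n := by omega
    rw [tVee_succ, ← mul_assoc, simpleNat_eq_simple hi,
      len_mul_simple (mul_tVee_lo_lt_hi hj hl hw rfl), ih (by omega), add_assoc]

theorem stdBasis_mul_tVee {j l : ℕ} (hj : j < n) (hl : l ≤ j) {w : Equiv.Perm (Fin n)}
    (hw : w ∈ parabolic n j) : stdBasis (w * tVee n (j + 1) l) = stdBasis w * descProd n j l := by
  induction l with
  | zero => rw [descProd_zero, mul_one]; rfl
  | succ l ih =>
    have hi : 1 ≤ j - l ∧ j - l < n := by omega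
    rw [tVee_succ, ← mul_assoc, simpleNat_eq_simple hi,
      stdBasis_mul_simple (mul_tVee_lo_lt_hi hj hl hw rfl), ih (by omega), descProd_succ,
      genNat_eq_gen hi, mul_assoc]

/-- The permutation `t^∨_{1,a_0} t^∨_{2,a_1} ⋯ t^∨_{m,a_{m-1}}`. The sequences with `a_j ≤ j`
parametrize `W_m`. -/
def codePerm (n : ℕ) {m : ℕ} (a : Fin m → ℕ) : Equiv.Perm (Fin n) :=
  (List.ofFn fun j => tVee n (j + 1) (a j)).prod

theorem codePerm_succ {m : ℕ} (a : Fin (m + 1) → ℕ) :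
    codePerm n a = codePerm n (Fin.init a) * tVee n (m + 1) (a (Fin.last m)) := by
  rw [codePerm, List.ofFn_succ', List.prod_concat]
  rfl

theorem codePerm_mem_parabolic {m : ℕ} (a : Fin m → ℕ) : codePerm n a ∈ parabolic n m := by
  induction m with
  | zero => exact one_mem _
  | succ m ih =>
    rw [codePerm_succ]
    exact mul_mem (parabolic_mono (Nat.le_succ m) (ih _)) (tVee_mem_parabolic n m _)

theorem exists_codePerm_eq {m : ℕ} (hm : m ≤ n) {w : Equiv.Perm (Fin n)}
    (hw : ∀ x : Fin n, m ≤ x.1 → w x = x) :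
    ∃ a : Fin m → ℕ, (∀ j, a j ≤ j) ∧ codePerm n a = w := by
  induction m generalizing w with
  | zero => exact ⟨Fin.elim0, fun j => j.elim0, Equiv.ext fun x => (hw x (Nat.zero_le _)).symm⟩
  | succ m ih =>
    set top : Fin n := ⟨m, hm⟩
    have htop : w (w⁻¹ top) = top := w.apply_symm_apply top
    have hle : (w⁻¹ top).1 ≤ m := by
      by_contra! h
      rw [hw _ h] at htop
      exact h.ne' (congrArg Fin.val htop)
    set t := tVee n (m + 1) (m - w⁻¹ top) with ht
    have ht_top : t⁻¹ top = w⁻¹ top :=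
      Equiv.Perm.inv_eq_iff_eq.2 (tVee_apply_of_add_eq hm (by omega)).symm
    obtain ⟨a, ha, hau⟩ := ih (w := w * t⁻¹) (by omega) fun x hx => by
      rw [Equiv.Perm.mul_apply]
      rcases hx.eq_or_lt with hx | hx
      · rw [show x = top from Fin.ext hx.symm, ht_top, htop]
      · rw [Equiv.Perm.inv_eq_iff_eq.2 (tVee_apply_of_gt hx).symm, hw x hx]
    refine ⟨Fin.snoc a (m - w⁻¹ top), fun j => ?_, ?_⟩
    · cases j using Fin.lastCases with
      | last => rw [Fin.snoc_last, Fin.val_last]; exact Nat.sub_le _ _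
      | cast j => rw [Fin.snoc_castSucc, Fin.val_castSucc]; exact ha j
    · rw [codePerm_succ, Fin.init_snoc, Fin.snoc_last, hau, ← ht, inv_mul_cancel_right]

theorem mem_parabolic_iff {k : ℕ} (hk : k ≤ n) {w : Equiv.Perm (Fin n)} :
    w ∈ parabolic n k ↔ ∀ x : Fin n, k ≤ x.1 → w x = x := by
  refine ⟨fun hw _ => apply_eq_of_mem_parabolic hw, fun hw => ?_⟩
  obtain ⟨a, -, rfl⟩ := exists_codePerm_eq hk hw
  exact codePerm_mem_parabolic a

theorem len_codePerm {m : ℕ} (hm : m ≤ n) {a : Fin m → ℕ} (ha : ∀ j, a j ≤ j) :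
    len (codePerm n a) = ∑ j, a j := by
  induction m with
  | zero => exact len_one
  | succ m ih =>
    rw [codePerm_succ, len_mul_tVee hm (ha (Fin.last m)) (codePerm_mem_parabolic _),
      ih (by omega) (init_apply_le ha), Fin.sum_univ_castSucc]
    rfl

theorem stdBasis_codePerm {m : ℕ} (hm : m ≤ n) {a : Fin m → ℕ} (ha : ∀ j, a j ≤ j) :
    stdBasis (codePerm n a) = (List.ofFn fun j => descProd n j (a j)).prod := by
  induction m with
  | zero => exact stdBasis_one
  | succ m ih =>
    rw [codePerm_succ, stdBasis_mul_tVee hm (ha (Fin.last m)) (codePerm_mem_parabolic _),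
      ih (by omega) (init_apply_le ha), List.ofFn_succ', List.prod_concat]
    rfl

theorem codePerm_apply {m : ℕ} (hm : m ≤ n) {a : Fin m → ℕ} {i : Fin m}
    (hi : ∀ j > i, (i : ℕ) - a i < j - a j) {x : Fin n} (hx : x.1 + a i = i) :
    (codePerm n a x).1 = i := by
  induction m with
  | zero => exact i.elim0
  | succ m ih =>
    rw [codePerm_succ, Equiv.Perm.mul_apply]
    cases i using Fin.lastCases with
    | last =>
      rw [tVee_apply_of_add_eq hm hx,
        apply_eq_of_mem_parabolic (k := m) (codePerm_mem_parabolic _) le_rfl, Fin.val_last]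
    | cast i =>
      have hlast := hi _ (Fin.castSucc_lt_last i)
      rw [Fin.val_castSucc, Fin.val_last] at hlast
      rw [Fin.val_castSucc] at hx
      rw [tVee_apply_of_lt (by omega)]
      exact ih (by omega) (fun j hj => hi j.castSucc (Fin.castSucc_lt_castSucc_iff.2 hj)) hx

theorem codePerm_inj {m : ℕ} (hm : m ≤ n) {a b : Fin m → ℕ} (ha : ∀ j, a j ≤ j)
    (hb : ∀ j, b j ≤ j) (h : codePerm n a = codePerm n b) : a = b := by
  induction m with
  | zero => exact Subsingleton.elim _ _
  | succ m ih =>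
    have hpos {c : Fin (m + 1) → ℕ} (hc : c (Fin.last m) ≤ m) :
        codePerm n c ⟨m - c (Fin.last m), by omega⟩ = ⟨m, hm⟩ :=
      Fin.ext (codePerm_apply hm (i := Fin.last m) (fun j hj => absurd hj (Fin.le_last j).not_gt)
        (Nat.sub_add_cancel hc))
    have ham : a (Fin.last m) ≤ m := ha (Fin.last m)
    have hbm : b (Fin.last m) ≤ m := hb (Fin.last m)
    have hlast : a (Fin.last m) = b (Fin.last m) := by
      have := (codePerm n b).injective ((h ▸ hpos ham).trans (hpos hbm).symm)
      rw [Fin.mk.injEq] at this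
      omega
    rw [codePerm_succ, codePerm_succ b, hlast, mul_left_inj] at h
    rw [← Fin.snoc_init_self a, ← Fin.snoc_init_self b, hlast,
      ih (by omega) (init_apply_le ha) (init_apply_le hb) h]

end Code

/-! ### The Kazhdan–Lusztig elements `C_w` for `w` with a suitable code -/

section KLCode

variable {n m : ℕ}

theorem prod_ofFn_smul {R A : Type*} [CommSemiring R] [Semiring A] [Algebra R A] (c : Fin m → R)
    (x : Fin m → A) : (List.ofFn fun j => c j • x j).prod = (∏ j, c j) • (List.ofFn x).prod := by
  simpa only [MultilinearMap.mkPiAlgebraFin_apply]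
    using (MultilinearMap.mkPiAlgebraFin R m A).map_smul_univ c x

theorem prod_ofFn_sum {A ι : Type*} [Semiring A] (s : Fin m → Finset ι)
    (x : Fin m → ι → A) :
    (List.ofFn fun j => ∑ i ∈ s j, x j i).prod
      = ∑ f ∈ Fintype.piFinset s, (List.ofFn fun j => x j (f j)).prod := by
  classical
  simpa only [MultilinearMap.mkPiAlgebraFin_apply]
    using (MultilinearMap.mkPiAlgebraFin ℕ m A).map_sum_finset x s

theorem le_of_mem_piFinset_range {ι : Type*} [Fintype ι] [DecidableEq ι] {a f : ι → ℕ}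
    (hf : f ∈ Fintype.piFinset fun j => Finset.range (a j + 1)) : f ≤ a :=
  fun j => Finset.mem_range_succ_iff.1 (Fintype.mem_piFinset.1 hf j)

theorem descSumProd_eq_sum (hm : m ≤ n) {a : Fin m → ℕ} (ha : ∀ j, a j ≤ j) :
    descSumProd n a = ∑ f ∈ Fintype.piFinset fun j => Finset.range (a j + 1),
      v ^ (∑ j, (a j - f j)) • stdBasis (codePerm n f) := by
  unfold descSumProd descSum
  rw [prod_ofFn_sum]
  refine Finset.sum_congr rfl fun f hf => ?_
  rw [prod_ofFn_smul, Finset.prod_pow_eq_pow_sum,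
    stdBasis_codePerm hm fun j => (le_of_mem_piFinset_range hf j).trans (ha j)]

theorem klBasis_codePerm (hm : m ≤ n) {a : Fin m → ℕ} (ha : ∀ j, a j ≤ j)
    (hmono : Monotone fun j : Fin m => (j : ℕ) - a j) :
    klBasis (codePerm n a) = ∑ f ∈ Fintype.piFinset fun j => Finset.range (a j + 1),
      v ^ (∑ j, (a j - f j)) • stdBasis (codePerm n f) := by
  rw [← descSumProd_eq_sum hm ha]
  refine klBasis_eq_of_bar_eq (bar_descSumProd hm ha hmono) ?_
  have ha_mem : a ∈ Fintype.piFinset fun j => Finset.range (a j + 1) :=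
    Fintype.mem_piFinset.2 fun j => Finset.self_mem_range_succ (a j)
  rw [descSumProd_eq_sum hm ha, ← Finset.add_sum_erase _ _ ha_mem]
  simp only [Nat.sub_self, Finset.sum_const_zero, pow_zero, one_smul, add_sub_cancel_left]
  refine sum_mem fun f hf => smul_mem_lattice (v_pow_mem_vIntPoly ?_) (Set.mem_univ _)
  obtain ⟨hne, hfa⟩ := Finset.mem_erase.1 hf
  obtain ⟨j, hj⟩ := Function.ne_iff.1 hne
  have hlt := lt_of_le_of_ne (le_of_mem_piFinset_range hfa j) hj
  exact Finset.sum_pos' (fun _ _ => Nat.zero_le _) ⟨j, Finset.mem_univ j, Nat.sub_pos_of_lt hlt⟩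

end KLCode

/-! ### The elements `w_k z` -/

section ShortestReps

variable {n k : ℕ}

theorem codePerm_zero (n k : ℕ) : codePerm n (0 : Fin k → ℕ) = 1 := by
  simp [codePerm, tVee]

theorem codePerm_append (a : Fin k → ℕ) (b : Fin (n - k) → ℕ) :
    codePerm n (Fin.append a b) = codePerm n a * tVeeProd k b := by
  have hleft (j : Fin k) : Fin.append a b (j.castLE (Nat.le_add_right k _)) = a j :=
    Fin.append_left a b j
  simp only [codePerm, tVeeProd, List.ofFn_add, List.prod_append, hleft, Fin.append_right,
    Fin.val_castLE, Fin.val_natAdd]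

theorem append_le {a : Fin k → ℕ} {b : Fin (n - k) → ℕ} (ha : ∀ j, a j ≤ j)
    (hb : ∀ m, b m ≤ k) (j : Fin (k + (n - k))) : Fin.append a b j ≤ j := by
  cases j using Fin.addCases with
  | left j => rw [Fin.append_left]; exact ha j
  | right m => rw [Fin.append_right]; exact (hb m).trans (Nat.le_add_right k m)

theorem sum_append (a : Fin k → ℕ) (b : Fin (n - k) → ℕ) :
    ∑ j, Fin.append a b j = ∑ j, a j + ∑ m, b m := by
  simp only [Fin.sum_univ_add, Fin.append_left, Fin.append_right]

theorem len_mul_tVeeProd (hk : k ≤ n) {w : Equiv.Perm (Fin n)} (hw : w ∈ parabolic n k)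
    {b : Fin (n - k) → ℕ} (hb : ∀ m, b m ≤ k) :
    len (w * tVeeProd k b) = len w + ∑ m, b m := by
  obtain ⟨a, ha, rfl⟩ := exists_codePerm_eq hk ((mem_parabolic_iff hk).1 hw)
  rw [← codePerm_append, len_codePerm (by omega) (append_le ha hb), sum_append, len_codePerm hk ha]

theorem tVeeProd_apply (hk : k ≤ n) {b : Fin (n - k) → ℕ} {m : Fin (n - k)}
    (hm : ∀ m' > m, k + m - b m < k + m' - b m') {x : Fin n} (hx : x.1 + b m = k + m) :
    (tVeeProd k b x).1 = k + m := by
  have h := codePerm_append (0 : Fin k → ℕ) b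
  rw [codePerm_zero, one_mul] at h
  rw [← h]
  refine codePerm_apply (i := Fin.natAdd k m) (by omega) (fun j hj => ?_) (by simpa using hx)
  cases j using Fin.addCases with
  | left j => exact absurd hj (by simp [Fin.lt_def]; omega)
  | right m' => simpa using hm m' (by simpa using hj)

theorem IsLongest.eq_codePerm (hk : k ≤ n) {wk : Equiv.Perm (Fin n)} (h : IsLongest k wk) :
    wk = codePerm n fun j : Fin k => (j : ℕ) := by
  obtain ⟨a, ha, rfl⟩ := exists_codePerm_eq hk ((mem_parabolic_iff hk).1 h.1)
  have hlen := h.2 _ (codePerm_mem_parabolic fun j : Fin k => (j : ℕ))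
  rw [len_codePerm hk ha, len_codePerm hk fun _ => le_rfl] at hlen
  have hsum := (Finset.sum_le_sum fun j _ => ha j).antisymm hlen
  congr
  exact funext fun j =>
    (Finset.sum_eq_sum_iff_of_le fun j _ => ha j).1 hsum j (Finset.mem_univ j)

theorem le_val_of_strictMono {p q : ℕ} {f : Fin p → Fin q} (hf : StrictMono f) (i : Fin p) :
    i.1 ≤ f i := by
  simpa using Finset.card_le_card_of_injOn f
    (fun j hj => Finset.mem_Iio.2 (hf (Finset.mem_Iio.1 hj)))
    (hf.injective.injOn (s := Finset.Iio i))

theorem val_add_le_of_strictMono {p q : ℕ} {f : Fin p → Fin q} (hf : StrictMono f) (i : Fin p) :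
    f i + p ≤ i + q := by
  have hcard := Finset.card_le_card_of_injOn f
    (fun j hj => Finset.mem_Ioi.2 (hf (Finset.mem_Ioi.1 hj)))
    (hf.injective.injOn (s := Finset.Ioi i))
  rw [Fin.card_Ioi, Fin.card_Ioi] at hcard
  omega

/-- The position of the `(m+1)`-st `∨` of a shortest representative `z`, as an element of
`Fin n`. -/
def veeElt (k : ℕ) (z : Equiv.Perm (Fin n)) (m : Fin (n - k)) : Fin n :=
  z⁻¹ ⟨k + m, by omega⟩

variable {z : Equiv.Perm (Fin n)}

theorem inv_lo_lt_inv_hi (hz : z ∈ shortestReps n k) {i : SimpleIdx n} (hi : k < i.1) :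
    z⁻¹ i.lo < z⁻¹ i.hi := by
  refine (apply_lo_lt_or_gt z⁻¹ i).resolve_right fun h => ?_
  have hmin := hz (simple i) (Subgroup.mem_sup_right (Subgroup.subset_closure ⟨i, hi, rfl⟩))
  have := len_simple_mul_of_gt h
  omega

theorem strictMono_veeElt (hz : z ∈ shortestReps n k) : StrictMono (veeElt k z) := fun m m' h =>
  strictMonoOn_of_lo_lt_hi (fun _ => inv_lo_lt_inv_hi hz) (Nat.le_add_right k m)
    (Nat.le_add_right k m') (Nat.add_lt_add_left h k)

theorem veePos_eq (hz : z ∈ shortestReps n k) (m : Fin (n - k)) :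
    veePos k z m = (veeElt k z m).1 + 1 := by
  rw [veePos, ← Finset.orderEmbOfFin_unique (card_veeSet k z) (f := veeElt k z)
    (fun x => by simp [veeSet, veeElt]) (strictMono_veeElt hz)]

theorem le_veeElt (hz : z ∈ shortestReps n k) (m : Fin (n - k)) : m.1 ≤ veeElt k z m :=
  le_val_of_strictMono (strictMono_veeElt hz) m

theorem veeElt_le (hz : z ∈ shortestReps n k) (m : Fin (n - k)) : (veeElt k z m).1 ≤ k + m := by
  have := val_add_le_of_strictMono (strictMono_veeElt hz) m
  omega

theorem veeDist_add_veeElt (hz : z ∈ shortestReps n k) (m : Fin (n - k)) :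
    veeElt k z m + veeDist k z m = k + m := by
  have := veeElt_le hz m
  rw [veeDist, veePos_eq hz]
  omega

theorem veeDist_le (hz : z ∈ shortestReps n k) (m : Fin (n - k)) : veeDist k z m ≤ k := by
  have := le_veeElt hz m
  have := veeDist_add_veeElt hz m
  omega

theorem tVeeProd_mul_inv_mem_parabolic (hk : k ≤ n) (hz : z ∈ shortestReps n k) :
    tVeeProd k (veeDist k z) * z⁻¹ ∈ parabolic n k := by
  refine (mem_parabolic_iff hk).2 fun x hx => ?_
  obtain ⟨m, hm⟩ : ∃ m : Fin (n - k), k + m.1 = x :=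
    ⟨⟨x - k, by omega⟩, Nat.add_sub_cancel' hx⟩
  have hzx : z⁻¹ x = veeElt k z m := congrArg (z⁻¹ : Equiv.Perm (Fin n)) (Fin.ext hm.symm)
  rw [Equiv.Perm.mul_apply, hzx]
  refine Fin.ext ((tVeeProd_apply hk (fun m' hm' => ?_) (veeDist_add_veeElt hz m)).trans hm)
  have := veeDist_add_veeElt hz m
  have := veeDist_add_veeElt hz m'
  have : (veeElt k z m).1 < veeElt k z m' := strictMono_veeElt hz hm'
  omega

theorem eq_one_of_len_eq_zero {w : Equiv.Perm (Fin n)} (h : len w = 0) : w = 1 := by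
  obtain ⟨l, rfl, hl⟩ := exists_reducedWord w
  rw [List.eq_nil_of_length_eq_zero (hl.trans h)]
  rfl

theorem eq_tVeeProd_veeDist (hk : k ≤ n) (hz : z ∈ shortestReps n k) :
    z = tVeeProd k (veeDist k z) := by
  set y := tVeeProd k (veeDist k z)
  have hy : y * z⁻¹ ∈ parabolic n k := tVeeProd_mul_inv_mem_parabolic hk hz
  have hmin : len z ≤ len y := by simpa using hz _ (Subgroup.mem_sup_left hy)
  have hlen_z : len z = len (z * y⁻¹) + ∑ m, veeDist k z m := by
    rw [← len_mul_tVeeProd hk (by simpa using inv_mem hy) (veeDist_le hz), inv_mul_cancel_right]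
  have hlen_y : len y = ∑ m, veeDist k z m := by
    simpa using len_mul_tVeeProd hk (one_mem (parabolic n k)) (veeDist_le hz)
  exact mul_inv_eq_one.1 (eq_one_of_len_eq_zero (by omega))

theorem monotone_sub_append (hz : z ∈ shortestReps n k) :
    Monotone fun j : Fin (k + (n - k)) =>
      (j : ℕ) - Fin.append (fun j : Fin k => (j : ℕ)) (veeDist k z) j := by
  intro i j hij
  cases i using Fin.addCases with
  | left i => simp
  | right m =>
    cases j using Fin.addCases with
    | left j => exact absurd hij (by simp [Fin.le_def]; omega)
    | right m' =>
      have hle : (veeElt k z m).1 ≤ veeElt k z m' :=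
        (strictMono_veeElt hz).monotone (by simpa using hij)
      have := veeDist_add_veeElt hz m
      have := veeDist_add_veeElt hz m'
      simp only [Fin.append_right, Fin.val_natAdd]
      omega

theorem klBasis_mul_eq_sum_append (hk : k ≤ n) {wk : Equiv.Perm (Fin n)} (hwk : IsLongest k wk)
    (hz : z ∈ shortestReps n k) :
    klBasis (wk * z) = ∑ f ∈ Fintype.piFinset fun j => Finset.range
        (Fin.append (fun j : Fin k => (j : ℕ)) (veeDist k z) j + 1),
      v ^ ((len (wk * z) : ℤ) - len (codePerm n f)) • stdBasis (codePerm n f) := by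
  have ha := append_le (a := fun j : Fin k => (j : ℕ)) (fun _ => le_rfl) (veeDist_le hz)
  have hcode : wk * z = codePerm n (Fin.append (fun j : Fin k => (j : ℕ)) (veeDist k z)) := by
    rw [codePerm_append, ← eq_tVeeProd_veeDist hk hz, ← hwk.eq_codePerm hk]
  rw [hcode, klBasis_codePerm (by omega) ha (monotone_sub_append hz)]
  refine Finset.sum_congr rfl fun f hf => ?_
  have hfa := le_of_mem_piFinset_range hf
  rw [Finset.sum_tsub_distrib _ fun j _ => hfa j, ← zpow_natCast,
    Nat.cast_sub (Finset.sum_le_sum fun j _ => hfa j), len_codePerm (by omega) ha,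
    len_codePerm (by omega) fun j => (hfa j).trans (ha j)]

theorem sum_piFinset_append {M : Type*} [AddCommMonoid M] {p q : ℕ} (s : Fin (p + q) → Finset ℕ)
    (F : (Fin (p + q) → ℕ) → M) :
    ∑ f ∈ Fintype.piFinset s, F f = ∑ a ∈ Fintype.piFinset fun i => s (Fin.castAdd q i),
      ∑ b ∈ Fintype.piFinset fun j => s (Fin.natAdd p j), F (Fin.append a b) := by
  rw [← Finset.sum_product']
  refine (Finset.sum_equiv (Fin.appendEquiv p q) (fun x => ?_) fun _ _ => rfl).symm
  simp only [Finset.mem_product, Fintype.mem_piFinset, Fin.appendEquiv_apply, Fin.forall_fin_add,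
    Fin.append_left, Fin.append_right]

theorem sum_parabolicFinset {M : Type*} [AddCommMonoid M] (hk : k ≤ n)
    (F : Equiv.Perm (Fin n) → M) :
    ∑ w ∈ parabolicFinset n k, F w
      = ∑ a ∈ Fintype.piFinset fun j : Fin k => Finset.range (j + 1), F (codePerm n a) := by
  have hle {a : Fin k → ℕ} (ha : a ∈ Fintype.piFinset fun j : Fin k => Finset.range (j + 1)) :=
    le_of_mem_piFinset_range ha
  refine (Finset.sum_nbij (codePerm n) (fun a _ => ?_) (fun a ha b hb => ?_) (fun w hw => ?_)
    fun _ _ => rfl).symm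
  · simpa [parabolicFinset] using codePerm_mem_parabolic a
  · exact codePerm_inj hk (hle ha) (hle hb)
  · have hw : w ∈ parabolic n k := by simpa [parabolicFinset] using hw
    obtain ⟨a, ha, rfl⟩ := exists_codePerm_eq hk ((mem_parabolic_iff hk).1 hw)
    exact ⟨a, by simpa [Nat.lt_succ_iff] using ha, rfl⟩

end ShortestReps

end SymHecke

theorem mainTheorem8 (n k : ℕ) (hk : k ≤ n)
    (wk : Equiv.Perm (Fin n)) (hwk : SymHecke.IsLongest k wk)
    (z : Equiv.Perm (Fin n)) (hz : z ∈ SymHecke.shortestReps n k) :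
    z = SymHecke.tVeeProd k (SymHecke.veeDist k z) ∧
    SymHecke.klBasis (wk * z) =
      ∑ w' ∈ SymHecke.parabolicFinset n k,
        ∑ i ∈ Fintype.piFinset fun m : Fin (n - k) => Finset.range (SymHecke.veeDist k z m + 1),
          SymHecke.v ^ ((SymHecke.len (wk * z) : ℤ) - (SymHecke.len w' : ℤ) - ∑ m, (i m : ℤ)) •
            SymHecke.stdBasis (w' * SymHecke.tVeeProd k i) := by
  refine ⟨SymHecke.eq_tVeeProd_veeDist hk hz, ?_⟩
  rw [SymHecke.klBasis_mul_eq_sum_append hk hwk hz, SymHecke.sum_piFinset_append,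
    SymHecke.sum_parabolicFinset hk]
  simp only [Fin.append_left, Fin.append_right]
  refine Finset.sum_congr rfl fun a _ => Finset.sum_congr rfl fun i hi => ?_
  have hik m : i m ≤ k :=
    (SymHecke.le_of_mem_piFinset_range hi m).trans (SymHecke.veeDist_le hz m)
  rw [SymHecke.codePerm_append,
    SymHecke.len_mul_tVeeProd hk (SymHecke.codePerm_mem_parabolic a) hik, Nat.cast_add,
    Nat.cast_sum, sub_sub]
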